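/- All polytopes are $n$-dimensional convex polytopes of finite volume in the Euclidean space $\mathbb{E}^n$, for one fixed $n$. A polytope is a Euclidean Coxeter polytope if any two of its facets are either parallel or form a dihedral angle $\pi/m$ with an integer $m\ge 2$. For a Euclidean Coxeter polytope $P$, let $G_P$ be the group generated by the reflections in the facets of $P$, and let $\Sigma(P)$ be its Coxeter diagram: its nodes are the facets, two nodes are joined by an $(m-2)$-fold edge if the facets form the angle $\pi/m$, and by a bold edge if the facets are parallel. A vertex $V$ of $P$ is called special if every linear part of an element of $G_P$ is the linear part of an element of $G_P$ that fixes $V$; for a special vertex $V$, let $G'_P$ be the stabilizer of $V$ in $G_P$ (a finite reflection group that, up to isomorphism, does not depend on the choice of $V$). Theorem. Let $F$ and $P$ be Euclidean Coxeter polytopes in $\mathbb{E}^n$. Then $F$ and $P$ have special vertices and, for any choice of special vertices in the definition of $G'_F$ and $G'_P$, the following two conditions are equivalent: (a) there is a Euclidean Coxeter polytope $T$ in $\mathbb{E}^n$ with $\Sigma(T)=\Sigma(P)$ (equality of Coxeter diagrams up to isomorphism) and $G_T\subset G_F$; (b) $G'_P$ embeds into $G'_F$ as a reflection subgroup, that is,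 there is an injective group homomorphism $G'_P\to G'_F$ that takes reflections to reflections. -/

import Mathlib

namespace EuclideanReflection

noncomputable section

open scoped RealInnerProductSpace

/-- The Euclidean space of dimension `n`. -/
abbrev E (n : ℕ) : Type := EuclideanSpace ℝ (Fin n)

/-- The hyperplane `{x | ⟪u, x⟫ = b}`, for a unit vector `u` (see `mem_hyperplane`). -/
def hyperplane {n : ℕ} (u : E n) (b : ℝ) : AffineSubspace ℝ (E n) :=
  AffineSubspace.mk' (b • u) (Submodule.span ℝ {u})ᗮ

theorem mem_hyperplane {n : ℕ} {u : E n} (hu : ‖u‖ = 1) (b : ℝ) (x : E n) :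
    x ∈ hyperplane u b ↔ ⟪u, x⟫ = b := by
  rw [hyperplane, AffineSubspace.mem_mk', Submodule.mem_orthogonal_singleton_iff_inner_right,
    vsub_eq_sub, inner_sub_right, inner_smul_right, real_inner_self_eq_norm_sq, hu]
  constructor <;> intro h <;> linarith

instance {n : ℕ} (u : E n) (b : ℝ) : Nonempty (hyperplane u b) :=
  ⟨⟨b • u, AffineSubspace.self_mem_mk' _ _⟩⟩

/-- The orthogonal reflection in the hyperplane `{x | ⟪u, x⟫ = b}`, `u` a unit vector. -/
def hyperplaneReflection {n : ℕ} (u : E n) (b : ℝ) : E n ≃ᵃⁱ[ℝ] E n :=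
  EuclideanGeometry.reflection (hyperplane u b)

/-- An isometry is a reflection if it is the orthogonal reflection in some hyperplane. -/
def IsReflection {n : ℕ} (g : E n ≃ᵃⁱ[ℝ] E n) : Prop :=
  ∃ (u : E n) (b : ℝ), ‖u‖ = 1 ∧ g = hyperplaneReflection u b

/-- A convex polytope with nonempty interior and finite volume in Euclidean `n`-space, given by the
unit outward normals and the offsets of its facets: it is the set of all `x` with
`⟪normal i, x⟫ ≤ offset i` for all `i`. The field `exists_facet_point` says that no inequality
is redundant, so that the indices correspond to the facets one to one. -/
structure Polytope (n : ℕ) where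
  numFacets : ℕ
  normal : Fin numFacets → E n
  offset : Fin numFacets → ℝ
  norm_normal : ∀ i, ‖normal i‖ = 1
  exists_interior_point : ∃ x : E n, ∀ i, ⟪normal i, x⟫ < offset i
  exists_facet_point : ∀ i, ∃ x : E n,
    ⟪normal i, x⟫ = offset i ∧ ∀ j, j ≠ i → ⟪normal j, x⟫ < offset j
  volume_lt_top :
    MeasureTheory.volume {x : E n | ∀ i, ⟪normal i, x⟫ ≤ offset i} < ⊤

namespace Polytope

variable {n : ℕ}

/-- The points of the polytope. -/
def carrier (P : Polytope n) : Set (E n) :=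
  {x | ∀ i, ⟪P.normal i, x⟫ ≤ P.offset i}

/-- The hyperplane that carries the `i`-th facet. -/
def facetHyperplane (P : Polytope n) (i : Fin P.numFacets) : AffineSubspace ℝ (E n) :=
  hyperplane (P.normal i) (P.offset i)

/-- The hyperplanes of the `i`-th and the `j`-th facet have a common point; for `i ≠ j` the
opposite case is that the two facets are parallel. -/
def FacetsMeet (P : Polytope n) (i j : Fin P.numFacets) : Prop :=
  ∃ x : E n, x ∈ P.facetHyperplane i ∧ x ∈ P.facetHyperplane j

/-- The dihedral angle between the `i`-th and the `j`-th facet, measured inside the polytope. -/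
def dihedralAngle (P : Polytope n) (i j : Fin P.numFacets) : ℝ :=
  Real.pi - InnerProductGeometry.angle (P.normal i) (P.normal j)

end Polytope

/-- A Euclidean Coxeter polytope: any two facets are parallel or form a dihedral angle `π / m`
with an integer `m ≥ 2`. -/
structure CoxeterPolytope (n : ℕ) extends Polytope n where
  dihedralAngle_eq : ∀ i j : Fin numFacets, i ≠ j → toPolytope.FacetsMeet i j →
    ∃ m : ℕ, 2 ≤ m ∧ toPolytope.dihedralAngle i j = Real.pi / m

namespace CoxeterPolytope

variable {n : ℕ}

open Classical in
/-- The label of the pair of nodes `i`, `j` of the Coxeter diagram: `1` on the diagonal, `m` if the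
facets form the dihedral angle `π / m`, and `0` (which stands for a bold edge, that is, for `∞`)
if they are parallel. -/
def diagramLabel (P : CoxeterPolytope n) (i j : Fin P.numFacets) : ℕ :=
  if i = j then 1
  else if P.FacetsMeet i j then sInf {m : ℕ | 2 ≤ m ∧ P.dihedralAngle i j = Real.pi / m}
  else 0

/-- Characterization of `diagramLabel` for facets that are not parallel. -/
theorem diagramLabel_spec (P : CoxeterPolytope n) {i j : Fin P.numFacets} (hij : i ≠ j)
    (h : P.FacetsMeet i j) :
    2 ≤ P.diagramLabel i j ∧ P.dihedralAngle i j = Real.pi / P.diagramLabel i j := by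
  have key : P.diagramLabel i j ∈ {m : ℕ | 2 ≤ m ∧ P.dihedralAngle i j = Real.pi / m} := by
    rw [diagramLabel, if_neg hij, if_pos h]
    exact Nat.sInf_mem (P.dihedralAngle_eq i j hij h)
  exact key

theorem diagramLabel_symm (P : CoxeterPolytope n) (i j : Fin P.numFacets) :
    P.diagramLabel j i = P.diagramLabel i j := by
  have h1 : (j = i) = (i = j) := propext eq_comm
  have h2 : P.FacetsMeet j i ↔ P.FacetsMeet i j :=
    ⟨fun ⟨x, a, b⟩ => ⟨x, b, a⟩, fun ⟨x, a, b⟩ => ⟨x, b, a⟩⟩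
  have h3 : P.dihedralAngle j i = P.dihedralAngle i j := by
    rw [Polytope.dihedralAngle, Polytope.dihedralAngle, InnerProductGeometry.angle_comm]
  by_cases h : P.FacetsMeet i j
  · simp only [diagramLabel, h1, h3, if_pos h, if_pos (h2.mpr h)]
  · simp only [diagramLabel, h1, if_neg h, if_neg (mt h2.mp h)]

/-- The Coxeter diagram of a Coxeter polytope, as a Coxeter matrix. Its nodes are the facets;
the entry `m ≥ 2` stands for an `(m - 2)`-fold edge and the entry `0` for a bold edge. -/
def diagram (P : CoxeterPolytope n) : CoxeterMatrix (Fin P.numFacets) where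
  M := Matrix.of fun i j => P.diagramLabel i j
  isSymm := by
    ext i j
    exact P.diagramLabel_symm i j
  diagonal i := by simp [diagramLabel]
  off_diagonal i j hij := by
    by_cases h : P.FacetsMeet i j
    · have := (P.diagramLabel_spec hij h).1
      simp only [Matrix.of_apply]
      omega
    · simp [diagramLabel, hij, h]

/-- Two Coxeter polytopes have the same Coxeter diagram, up to a renumbering of the nodes. -/
def SameDiagram (P Q : CoxeterPolytope n) : Prop :=
  ∃ e : Fin P.numFacets ≃ Fin Q.numFacets, P.diagram.reindex e = Q.diagram

/-- The group generated by the reflections in the facets. -/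
def reflectionGroup (P : CoxeterPolytope n) : Subgroup (E n ≃ᵃⁱ[ℝ] E n) :=
  Subgroup.closure (Set.range fun i => hyperplaneReflection (P.normal i) (P.offset i))

/-- The stabilizer of the point `V` in the group generated by the reflections in the facets. -/
def stabilizer (P : CoxeterPolytope n) (V : E n) : Subgroup (E n ≃ᵃⁱ[ℝ] E n) where
  carrier := {g | g ∈ P.reflectionGroup ∧ g V = V}
  one_mem' := ⟨one_mem _, rfl⟩
  mul_mem' := by
    rintro a b ⟨ha, ha'⟩ ⟨hb, hb'⟩
    exact ⟨mul_mem ha hb, by rw [AffineIsometryEquiv.coe_mul, Function.comp_apply, hb', ha']⟩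
  inv_mem' := by
    rintro a ⟨ha, ha'⟩
    exact ⟨inv_mem ha, by
      have h : a⁻¹ (a V) = V := a.symm_apply_apply V
      rwa [ha'] at h⟩

/-- A special vertex of `P`: a vertex whose stabilizer contains the linear parts of all elements of
the reflection group. -/
def IsSpecialVertex (P : CoxeterPolytope n) (V : E n) : Prop :=
  V ∈ Set.extremePoints ℝ P.carrier ∧
    ∀ g ∈ P.reflectionGroup, ∃ h ∈ P.stabilizer V,
      h.linearIsometryEquiv = g.linearIsometryEquiv

end CoxeterPolytope

/-- The group `H` embeds into the group `G` as a reflection subgroup: there is an injective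
homomorphism that takes reflections to reflections. -/
def EmbedsAsReflectionSubgroup {n : ℕ} (H G : Subgroup (E n ≃ᵃⁱ[ℝ] E n)) : Prop :=
  ∃ φ : H →* G, Function.Injective φ ∧
    ∀ g : H, IsReflection (g : E n ≃ᵃⁱ[ℝ] E n) → IsReflection (φ g : E n ≃ᵃⁱ[ℝ] E n)

end

end EuclideanReflection

/-! Both conditions concern linear parts. At a special vertex the stabilizer maps isomorphically
onto the group of all linear parts, so through that vertex passes a mirror in every direction in
which the reflection group has mirrors.

From (a) to (b) (`embeds_of_sameDiagram`): the diagram determines the Gram matrix of the unit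
normals, parallel facets giving -1, and the normals span the space. So some linear isometry `O`
carries the normals of `P` to those of `T`. Conjugation by `O` sends linear parts of the group of
`P` to linear parts of the group of `F`, and these lift uniquely to the stabilizer of the special
vertex of `F`.

From (b) to (a) (`exists_sameDiagram_of_embeds`): an embedding preserves the orders of products of
two reflections. The order alone does not determine the angle, but together with the
crystallographic restriction that `4 * cos ^ 2` is an integer it determines the angle up to sign
(`inner_sq_eq_of_pow_eq_one_iff`). The normals of the facets at a vertex are linearly independent
with nonpositive products, so their nonorthogonality graph is a forest and signs can be adjusted to
make the Gram matrices equal (`exists_signs`). Hence the embedding is induced by a linear isometry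
`O`. As the vertex of `P` is special, `O` sends every facet normal of `P` to a mirror direction of
`F`. Put the facets of `P` at the vertex on mirrors through the special vertex of `F`, and every
other facet on a parallel mirror farther out. The result is a polytope with the diagram of `P`
whatever the positive distances are, because the outer normals are nonpositive combinations of
disjoint blocks of the normals at the vertex (`exists_vertex_coeff`): the shape is a product of
simplices.

Special vertices exist because there are finitely many mirror directions. Mirrors in the directions
of a simple system have a common point by linear independence, and this point is moved into the
polytope by the group. All of this rests on the polytope being a fundamental domain, which is proved
by Tits' argument (`slack_pos_of_not_isRightDescent`). -/

namespace EuclideanReflection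

open scoped RealInnerProductSpace

variable {n : ℕ}

/-! ### Isometries, their linear parts, and hyperplane reflections. -/

/-- The linear part of an isometry, as a group homomorphism. -/
noncomputable def linHom : (E n ≃ᵃⁱ[ℝ] E n) →* (E n ≃ₗᵢ[ℝ] E n) where
  toFun g := g.linearIsometryEquiv
  map_one' := rfl
  map_mul' _ _ := rfl

theorem map_sub_map (g : E n ≃ᵃⁱ[ℝ] E n) (x y : E n) : g x - g y = linHom g (x - y) :=
  (g.map_vsub x y).symm

theorem map_eq_add (g : E n ≃ᵃⁱ[ℝ] E n) (x y : E n) : g x = g y + linHom g (x - y) := by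
  rw [← map_sub_map]; abel

theorem map_add_eq (g : E n ≃ᵃⁱ[ℝ] E n) (x v : E n) : g (x + v) = g x + linHom g v := by
  rw [map_eq_add g (x + v) x, add_sub_cancel_left]

theorem isometry_ext {g h : E n ≃ᵃⁱ[ℝ] E n} (hl : linHom g = linHom h) {x : E n}
    (hx : g x = h x) : g = h := by
  ext1 y
  rw [map_eq_add g y x, map_eq_add h y x, hl, hx]

theorem mul_apply' (g h : E n ≃ᵃⁱ[ℝ] E n) (x : E n) : (g * h) x = g (h x) := rfl

theorem lin_mul_apply (g h : E n ≃ₗᵢ[ℝ] E n) (x : E n) : (g * h) x = g (h x) := rfl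

theorem inv_apply_self' (g : E n ≃ᵃⁱ[ℝ] E n) (x : E n) : g⁻¹ (g x) = x := g.symm_apply_apply x

theorem apply_inv_self' (g : E n ≃ᵃⁱ[ℝ] E n) (x : E n) : g (g⁻¹ x) = x := g.apply_symm_apply x

theorem inner_self_of_unit {u : E n} (hu : ‖u‖ = 1) : ⟪u, u⟫ = 1 := by
  rw [real_inner_self_eq_norm_sq, hu]; norm_num

theorem reflection_apply {u : E n} (hu : ‖u‖ = 1) (b : ℝ) (x : E n) :
    hyperplaneReflection u b x = x - (2 * (⟪u, x⟫ - b)) • u := by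
  have hproj : (EuclideanGeometry.orthogonalProjection (hyperplane u b) x : E n)
      = x - (⟪u, x⟫ - b) • u := by
    rw [EuclideanGeometry.coe_orthogonalProjection_eq_iff_mem]
    refine ⟨?_, ?_⟩
    · rw [mem_hyperplane hu, inner_sub_right, inner_smul_right, inner_self_of_unit hu]; ring
    · rw [hyperplane, AffineSubspace.direction_mk', Submodule.orthogonal_orthogonal]
      rw [vsub_eq_sub, sub_sub_cancel]
      exact Submodule.smul_mem _ _ (Submodule.mem_span_singleton_self u)
  rw [hyperplaneReflection, EuclideanGeometry.reflection_apply', hproj, vsub_eq_sub, vadd_eq_add,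
    mul_smul, two_smul]
  abel

theorem linHom_reflection_apply {u : E n} (hu : ‖u‖ = 1) (b : ℝ) (v : E n) :
    linHom (hyperplaneReflection u b) v = v - (2 * ⟪u, v⟫) • u := by
  have h := map_sub_map (hyperplaneReflection u b) v 0
  rw [sub_zero] at h
  rw [← h, reflection_apply hu, reflection_apply hu, inner_zero_right]
  module

theorem linHom_reflection_congr {u : E n} (hu : ‖u‖ = 1) (b b' : ℝ) :
    linHom (hyperplaneReflection u b) = linHom (hyperplaneReflection u b') := by
  ext1 v
  rw [linHom_reflection_apply hu, linHom_reflection_apply hu]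

theorem reflection_fixed {u : E n} (hu : ‖u‖ = 1) {b : ℝ} {x : E n} :
    hyperplaneReflection u b x = x ↔ ⟪u, x⟫ = b := by
  have hu0 : u ≠ 0 := by rintro rfl; simp at hu
  rw [reflection_apply hu, sub_eq_self, smul_eq_zero, or_iff_left hu0]
  constructor <;> intro h <;> linarith

theorem reflection_mul_self {u : E n} (hu : ‖u‖ = 1) (b : ℝ) :
    hyperplaneReflection u b * hyperplaneReflection u b = 1 := by
  refine AffineIsometryEquiv.ext fun x => ?_
  rw [mul_apply', reflection_apply hu, reflection_apply hu, inner_sub_right, inner_smul_right,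
    inner_self_of_unit hu, AffineIsometryEquiv.coe_one, id]
  module

theorem reflection_ne_one {u : E n} (hu : ‖u‖ = 1) (b : ℝ) : hyperplaneReflection u b ≠ 1 := by
  intro h
  have h1 : hyperplaneReflection u b ((b + 1) • u) = (b + 1) • u := by rw [h]; rfl
  rw [reflection_fixed hu, inner_smul_right, inner_self_of_unit hu] at h1
  linarith

theorem reflection_inv {u : E n} (hu : ‖u‖ = 1) (b : ℝ) :
    (hyperplaneReflection u b)⁻¹ = hyperplaneReflection u b :=
  inv_eq_of_mul_eq_one_left (reflection_mul_self hu b)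

theorem norm_linHom (g : E n ≃ₗᵢ[ℝ] E n) {u : E n} (hu : ‖u‖ = 1) : ‖g u‖ = 1 := by
  rw [LinearIsometryEquiv.norm_map, hu]

theorem reflection_conj (g : E n ≃ᵃⁱ[ℝ] E n) {u : E n} (hu : ‖u‖ = 1) (b : ℝ) :
    g * hyperplaneReflection u b * g⁻¹
      = hyperplaneReflection (linHom g u) (b + ⟪linHom g u, g 0⟫) := by
  rw [mul_inv_eq_iff_eq_mul]
  ext1 x
  rw [mul_apply', mul_apply', reflection_apply hu, reflection_apply (norm_linHom _ hu),
    sub_eq_add_neg, map_add_eq, map_eq_add g x 0, sub_zero, inner_add_right,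
    LinearIsometryEquiv.inner_map_map, map_neg, map_smul]
  module

theorem reflection_conj' (g : E n ≃ᵃⁱ[ℝ] E n) {u : E n} (hu : ‖u‖ = 1) {b : ℝ} {x : E n}
    (hx : ⟪u, x⟫ = b) :
    g * hyperplaneReflection u b * g⁻¹
      = hyperplaneReflection (linHom g u) ⟪linHom g u, g x⟫ := by
  rw [reflection_conj g hu, map_eq_add g x 0, inner_add_right, sub_zero,
    LinearIsometryEquiv.inner_map_map, hx, add_comm]

theorem eq_reflection_of_fixed {g : E n ≃ᵃⁱ[ℝ] E n} {u : E n} (hu : ‖u‖ = 1) {b : ℝ} {x : E n}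
    (hl : linHom g = linHom (hyperplaneReflection u b)) (hx : g x = x) :
    g = hyperplaneReflection u ⟪u, x⟫ := by
  refine isometry_ext (x := x) (hl.trans (linHom_reflection_congr hu _ _)) ?_
  rw [hx, (reflection_fixed hu).2 rfl]

theorem linHom_conj_reflection (O : E n ≃ₗᵢ[ℝ] E n) {u : E n} (hu : ‖u‖ = 1) (b b' : ℝ) :
    O * linHom (hyperplaneReflection u b) * O⁻¹ = linHom (hyperplaneReflection (O u) b') := by
  rw [mul_inv_eq_iff_eq_mul]
  ext1 x
  rw [lin_mul_apply, lin_mul_apply, linHom_reflection_apply hu,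
    linHom_reflection_apply (norm_linHom _ hu), LinearIsometryEquiv.inner_map_map, map_sub,
    map_smul]

/-- Reflections with the same linear part have the same unit normal, up to sign. -/
theorem eq_or_eq_neg_of_linHom_eq {u v : E n} (hu : ‖u‖ = 1) (hv : ‖v‖ = 1) {b c : ℝ}
    (h : linHom (hyperplaneReflection u b) = linHom (hyperplaneReflection v c)) :
    u = v ∨ u = -v := by
  have h1 : linHom (hyperplaneReflection u b) u = linHom (hyperplaneReflection v c) u := by rw [h]
  rw [linHom_reflection_apply hu, linHom_reflection_apply hv, inner_self_of_unit hu] at h1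
  have h2 : u = ⟪v, u⟫ • v := by
    have : (2:ℝ) • u = (2:ℝ) • (⟪v, u⟫ • v) := by
      have h3 := congrArg (fun z => u - z) h1
      simp only [sub_sub_cancel, mul_smul] at h3
      simpa using h3
    exact smul_right_injective _ (two_ne_zero) this
  have h3 : |⟪v, u⟫| = 1 := by
    have := congrArg norm h2
    rw [norm_smul, hu, hv, mul_one, Real.norm_eq_abs] at this
    exact this.symm
  rcases (abs_eq zero_le_one).1 h3 with h4 | h4
  · left; rw [h4, one_smul] at h2; exact h2
  · right; rw [h4, neg_one_smul] at h2; exact h2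

theorem reflection_neg {u : E n} (hu : ‖u‖ = 1) (b : ℝ) :
    hyperplaneReflection (-u) (-b) = hyperplaneReflection u b := by
  ext1 x
  rw [reflection_apply hu, reflection_apply (by rwa [norm_neg]), inner_neg_left]
  module

theorem inner_sq_lt_one {u v : E n} (hu : ‖u‖ = 1) (hv : ‖v‖ = 1) (h1 : u ≠ v) (h2 : u ≠ -v) :
    ⟪u, v⟫ ^ 2 < 1 := by
  have h3 := (inner_lt_one_iff_real_of_norm_eq_one hu hv).2 h1
  have h4 := (inner_lt_one_iff_real_of_norm_eq_one hu (by rwa [norm_neg])).2 h2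
  rw [inner_neg_right] at h4
  nlinarith

/-- Mirrors that are not parallel have a common point. -/
theorem exists_inner_eq_and {u v : E n} (hu : ‖u‖ = 1) (hv : ‖v‖ = 1) (h1 : u ≠ v) (h2 : u ≠ -v)
    (a b : ℝ) : ∃ x : E n, ⟪u, x⟫ = a ∧ ⟪v, x⟫ = b := by
  have hc := inner_sq_lt_one hu hv h1 h2
  set c := ⟪u, v⟫ with hcdef
  have hc' : 1 - c ^ 2 ≠ 0 := by linarith
  refine ⟨((a - c * b) / (1 - c ^ 2)) • u + ((b - c * a) / (1 - c ^ 2)) • v, ?_, ?_⟩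
  · rw [inner_add_right, inner_smul_right, inner_smul_right, inner_self_of_unit hu, ← hcdef]
    field_simp
    ring
  · rw [inner_add_right, inner_smul_right, inner_smul_right, inner_self_of_unit hv,
      real_inner_comm, ← hcdef]
    field_simp
    ring

/-! ### Polytopes of finite volume: no redundant facets, no rays, boundedness. -/

namespace Polytope

/-- The interior of the polytope. -/
def openCarrier (P : Polytope n) : Set (E n) :=
  {x | ∀ i, ⟪P.normal i, x⟫ < P.offset i}

theorem isOpen_openCarrier (P : Polytope n) : IsOpen P.openCarrier := by
  have : P.openCarrier = ⋂ i, {x | ⟪P.normal i, x⟫ < P.offset i} := by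
    ext x; simp [openCarrier]
  rw [this]
  exact isOpen_iInter_of_finite fun i => isOpen_lt (by fun_prop) continuous_const

theorem segment_mem_openCarrier (P : Polytope n) {x p : E n} (hx : x ∈ P.carrier)
    (hp : p ∈ P.openCarrier) {t : ℝ} (ht : 0 < t) (ht1 : t ≤ 1) :
    x + t • (p - x) ∈ P.openCarrier := by
  intro i
  have h1 := hx i
  have h2 := hp i
  rw [inner_add_right, inner_smul_right, inner_sub_right]
  nlinarith [mul_lt_mul_of_pos_left h2 ht]

theorem offset_lt_of_normal_eq (P : Polytope n) {i j : Fin P.numFacets} (hij : i ≠ j)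
    (h : P.normal i = P.normal j) : P.offset i < P.offset j := by
  obtain ⟨x, hx, hx'⟩ := P.exists_facet_point i
  have := hx' j hij.symm
  rwa [← h, hx] at this

theorem normal_injective (P : Polytope n) : Function.Injective P.normal := by
  intro i j h
  by_contra hij
  exact lt_asymm (P.offset_lt_of_normal_eq hij h)
    (P.offset_lt_of_normal_eq (Ne.symm hij) h.symm)

theorem facetsMeet_iff (P : Polytope n) {i j : Fin P.numFacets} (hij : i ≠ j) :
    P.FacetsMeet i j ↔ P.normal i ≠ -P.normal j := by
  have hi := P.norm_normal i
  have hj := P.norm_normal j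
  simp only [FacetsMeet, facetHyperplane, mem_hyperplane hi, mem_hyperplane hj]
  constructor
  · rintro ⟨x, hxi, hxj⟩ h
    obtain ⟨p, hp⟩ := P.exists_interior_point
    have h1 := hp i
    have h2 := hp j
    rw [h, inner_neg_left] at h1 hxi
    linarith
  · intro h
    exact exists_inner_eq_and hi hj (P.normal_injective.ne hij) h _ _

/-- A polytope of finite volume contains no ray. -/
theorem eq_zero_of_inner_nonpos (P : Polytope n) {d : E n} (hd : ∀ i, ⟪P.normal i, d⟫ ≤ 0) :
    d = 0 := by
  by_contra hd0
  obtain ⟨p, hp⟩ := P.exists_interior_point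
  obtain ⟨ε, hε, hball⟩ := Metric.isOpen_iff.1 P.isOpen_openCarrier p hp
  have hdn : 0 < ‖d‖ := norm_pos_iff.2 hd0
  -- With this step length consecutive centres are `2 * ε` apart, so infinitely many disjoint balls
  -- of radius `ε` fit into the polytope.
  set s : ℝ := 2 * ε / ‖d‖ with hs
  have hspos : 0 < s := by positivity
  have hvol := P.volume_lt_top
  have hsub : (⋃ k : ℕ, Metric.ball (p + ((k : ℝ) * s) • d) ε) ⊆
      {x : E n | ∀ i, ⟪P.normal i, x⟫ ≤ P.offset i} := by
    intro x hx i
    obtain ⟨k, hk⟩ := Set.mem_iUnion.1 hx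
    have h1 : x - ((k : ℝ) * s) • d ∈ Metric.ball p ε := by
      rw [mem_ball_iff_norm] at hk ⊢
      convert hk using 2
      abel
    have h2 := hball h1 i
    rw [inner_sub_right, inner_smul_right] at h2
    have h3 : (k : ℝ) * s * ⟪P.normal i, d⟫ ≤ 0 :=
      mul_nonpos_of_nonneg_of_nonpos (by positivity) (hd i)
    linarith
  have hdisj : Pairwise (Function.onFun Disjoint
      fun k : ℕ => Metric.ball (p + ((k : ℝ) * s) • d) ε) := by
    intro k l hkl
    refine Metric.ball_disjoint_ball ?_
    rw [dist_add_left, dist_eq_norm, ← sub_smul, ← sub_mul, norm_smul, norm_mul,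
      Real.norm_of_nonneg hspos.le, mul_assoc, hs, div_mul_cancel₀ _ hdn.ne']
    have : (1 : ℝ) ≤ ‖(k : ℝ) - l‖ := by
      have h4 : (1 : ℤ) ≤ |(k : ℤ) - l| := Int.one_le_abs (by omega)
      rw [Real.norm_eq_abs]
      exact_mod_cast h4
    nlinarith
  have h5 := MeasureTheory.measure_iUnion (μ := MeasureTheory.volume) hdisj
    fun _ => Metric.isOpen_ball.measurableSet
  have h6 : (∑' k : ℕ, MeasureTheory.volume (Metric.ball (p + ((k : ℝ) * s) • d) ε)) = ⊤ := by
    have : ∀ k : ℕ, MeasureTheory.volume (Metric.ball (p + ((k : ℝ) * s) • d) ε)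
        = MeasureTheory.volume (Metric.ball (0 : E n) ε) := fun k =>
      MeasureTheory.Measure.addHaar_ball_center _ _ _
    simp_rw [this]
    exact ENNReal.tsum_const_eq_top_of_ne_zero (Metric.measure_ball_pos _ _ hε).ne'
  have h7 := MeasureTheory.measure_mono (μ := MeasureTheory.volume) hsub
  rw [h5, h6] at h7
  exact absurd (lt_of_le_of_lt h7 hvol) (lt_irrefl _)

theorem eq_zero_of_inner_eq_zero (P : Polytope n) {d : E n} (hd : ∀ i, ⟪P.normal i, d⟫ = 0) :
    d = 0 :=
  P.eq_zero_of_inner_nonpos fun i => (hd i).le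

theorem span_normal (P : Polytope n) : Submodule.span ℝ (Set.range P.normal) = ⊤ := by
  rw [← Submodule.orthogonal_eq_bot_iff, Submodule.eq_bot_iff]
  intro d hd
  exact P.eq_zero_of_inner_eq_zero fun i =>
    (Submodule.mem_orthogonal _ _).1 hd _ (Submodule.subset_span ⟨i, rfl⟩)

/-- Normalizing an unbounded sequence of solutions and passing to a limit on the unit sphere gives a
nonzero recession direction. -/
theorem exists_bound_of_noRay {ι : Type*} [Finite ι] (β : ι → E n) (b : ι → ℝ)
    (h : ∀ d, (∀ i, ⟪β i, d⟫ ≤ 0) → d = 0) :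
    Bornology.IsBounded {x : E n | ∀ i, ⟪β i, x⟫ ≤ b i} := by
  by_contra hunb
  have hex : ∀ k : ℕ, ∃ x ∈ {x : E n | ∀ i, ⟪β i, x⟫ ≤ b i}, (k : ℝ) + 1 ≤ ‖x‖ := by
    intro k
    by_contra! hk
    exact hunb (isBounded_iff_forall_norm_le.2 ⟨k + 1, fun x hx => (hk x hx).le⟩)
  choose x hx hxk using hex
  have hpos : ∀ k, 0 < ‖x k‖ := fun k => lt_of_lt_of_le (by positivity) (hxk k)
  set y : ℕ → E n := fun k => ‖x k‖⁻¹ • x k with hy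
  have hyS : ∀ k, y k ∈ Metric.sphere (0 : E n) 1 := by
    intro k
    rw [mem_sphere_zero_iff_norm, hy]
    simp only [norm_smul, norm_inv, norm_norm]
    exact inv_mul_cancel₀ (hpos k).ne'
  obtain ⟨d, hdS, φ, hφ, hlim⟩ := (isCompact_sphere (0 : E n) 1).tendsto_subseq hyS
  have hd0 : d = 0 := by
    refine h d fun i => ?_
    have h1 : Filter.Tendsto (fun k => ⟪β i, y (φ k)⟫) Filter.atTop (nhds ⟪β i, d⟫) :=
      ((continuous_const.inner continuous_id).tendsto d).comp hlim
    have h2 : Filter.Tendsto (fun k : ℕ => |b i| * (1 / ((k : ℝ) + 1))) Filter.atTop (nhds 0) := by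
      simpa using tendsto_one_div_add_atTop_nhds_zero_nat.const_mul |b i|
    refine le_of_tendsto_of_tendsto' h1 h2 fun k => ?_
    simp only [hy, inner_smul_right]
    have h3 := hx (φ k) i
    have h4 : ((k : ℝ) + 1) ≤ ‖x (φ k)‖ := by
      refine le_trans ?_ (hxk (φ k))
      have : (k : ℝ) ≤ φ k := by exact_mod_cast hφ.id_le k
      linarith
    calc ‖x (φ k)‖⁻¹ * ⟪β i, x (φ k)⟫ ≤ ‖x (φ k)‖⁻¹ * |b i| := by
          refine mul_le_mul_of_nonneg_left (h3.trans (le_abs_self _)) ?_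
          exact inv_nonneg.2 (hpos _).le
      _ ≤ ((k : ℝ) + 1)⁻¹ * |b i| := by
          refine mul_le_mul_of_nonneg_right ?_ (abs_nonneg _)
          exact inv_anti₀ (by positivity) h4
      _ = |b i| * (1 / ((k : ℝ) + 1)) := by rw [one_div, mul_comm]
  rw [hd0] at hdS
  simp at hdS

theorem isBounded_carrier (P : Polytope n) : Bornology.IsBounded P.carrier :=
  exists_bound_of_noRay _ _ fun _ hd => P.eq_zero_of_inner_nonpos hd

end Polytope

/-! ### The Gram matrix of the normals. -/

namespace CoxeterPolytope

theorem diagram_apply (P : CoxeterPolytope n) (i j : Fin P.numFacets) :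
    P.diagram i j = P.diagramLabel i j := rfl

/-- The Gram matrix of the normals in terms of the Coxeter matrix; the label `0` gives `-1`, since
`π / 0 = 0`. -/
theorem inner_normal (P : CoxeterPolytope n) (i j : Fin P.numFacets) :
    ⟪P.normal i, P.normal j⟫ = -Real.cos (Real.pi / P.diagram i j) := by
  rw [diagram_apply]
  by_cases hij : i = j
  · subst hij
    rw [inner_self_of_unit (P.norm_normal i)]
    simp [diagramLabel]
  by_cases h : P.FacetsMeet i j
  · rw [← (P.diagramLabel_spec hij h).2, Polytope.dihedralAngle, Real.cos_pi_sub, neg_neg,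
      InnerProductGeometry.cos_angle, P.norm_normal, P.norm_normal]
    simp
  · have h1 : P.normal i = -P.normal j := by
      by_contra h1
      exact h ((P.facetsMeet_iff hij).2 h1)
    rw [h1, inner_neg_left, inner_self_of_unit (P.norm_normal j)]
    simp [diagramLabel, hij, h]

theorem inner_normal_nonpos (P : CoxeterPolytope n) {i j : Fin P.numFacets} (hij : i ≠ j) :
    ⟪P.normal i, P.normal j⟫ ≤ 0 := by
  rw [inner_normal, neg_nonpos]
  have h1 := P.diagram.off_diagonal i j hij
  rcases Nat.eq_zero_or_pos (P.diagram i j) with h | h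
  · rw [h]; simp
  · have h2 : (2 : ℝ) ≤ P.diagram i j := by
      have : 2 ≤ P.diagram i j := by
        have : P.diagram i j ≠ 1 := h1
        omega
      exact_mod_cast this
    refine Real.cos_nonneg_of_mem_Icc ⟨?_, ?_⟩
    · have : 0 ≤ Real.pi / (P.diagram i j : ℝ) := by positivity
      linarith [Real.pi_pos]
    · exact div_le_div_of_nonneg_left Real.pi_pos.le two_pos h2

end CoxeterPolytope

/-! ### Chebyshev-type recursion -/

/-- The sequence `sin (k θ) / sin θ` for `c = cos θ`, extended to all real `c` by its recursion. -/
noncomputable def sineRatio (c : ℝ) : ℕ → ℝ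
  | 0 => 0
  | 1 => 1
  | k + 2 => 2 * c * sineRatio c (k + 1) - sineRatio c k

theorem sineRatio_mul_sin (θ : ℝ) (k : ℕ) :
    sineRatio (Real.cos θ) k * Real.sin θ = Real.sin (k * θ) := by
  induction k using Nat.strong_induction_on with
  | _ k ih =>
    match k, ih with
    | 0, _ => simp [sineRatio]
    | 1, _ => simp [sineRatio]
    | k + 2, ih =>
      have h1 := ih (k + 1) (by omega)
      have h2 := ih k (by omega)
      rw [sineRatio, sub_mul, mul_assoc, h1, h2]
      push_cast
      rw [show ((k : ℝ) + 2) * θ = (k + 1) * θ + θ by ring,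
        show (k : ℝ) * θ = (k + 1) * θ - θ by ring, Real.sin_add, Real.sin_sub]
      ring

theorem sineRatio_one (k : ℕ) : sineRatio 1 k = k := by
  induction k using Nat.strong_induction_on with
  | _ k ih =>
    match k, ih with
    | 0, _ => simp [sineRatio]
    | 1, _ => simp [sineRatio]
    | k + 2, ih =>
      rw [sineRatio, ih (k + 1) (by omega), ih k (by omega)]
      push_cast
      ring

theorem sin_pi_div_pos {m : ℕ} (hm : 2 ≤ m) : 0 < Real.sin (Real.pi / m) := by
  have h2 : (2 : ℝ) ≤ m := by exact_mod_cast hm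
  refine Real.sin_pos_of_pos_of_lt_pi (by positivity) ?_
  rw [div_lt_iff₀ (by positivity)]
  nlinarith [Real.pi_pos]

/-- The label `m = 0` of parallel facets is included: then the cosine is 1 and the sequence is `k`,
with no upper bound on `k` needed. -/
theorem sineRatio_nonneg {m k : ℕ} (hm : m ≠ 1) (hk : m = 0 ∨ k ≤ m) :
    0 ≤ sineRatio (Real.cos (Real.pi / m)) k := by
  rcases Nat.eq_zero_or_pos m with rfl | hm0
  · simp [sineRatio_one]
  · have hk' : k ≤ m := by omega
    have hs := sin_pi_div_pos (show 2 ≤ m by omega)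
    refine nonneg_of_mul_nonneg_left ?_ hs
    rw [sineRatio_mul_sin]
    have hmR : (0 : ℝ) < m := by exact_mod_cast hm0
    refine Real.sin_nonneg_of_nonneg_of_le_pi (by positivity) ?_
    rw [mul_div_assoc', div_le_iff₀ hmR, mul_comm]
    exact mul_le_mul_of_nonneg_left (by exact_mod_cast hk') Real.pi_pos.le

theorem sineRatio_pos {m k : ℕ} (hm : m ≠ 1) (hk0 : 0 < k) (hk : m = 0 ∨ k < m) :
    0 < sineRatio (Real.cos (Real.pi / m)) k := by
  rcases Nat.eq_zero_or_pos m with rfl | hm0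
  · simpa [sineRatio_one] using hk0
  · have hk' : k < m := by omega
    have hs := sin_pi_div_pos (show 2 ≤ m by omega)
    refine pos_of_mul_pos_left ?_ hs.le
    rw [sineRatio_mul_sin]
    have hmR : (0 : ℝ) < m := by exact_mod_cast hm0
    refine Real.sin_pos_of_pos_of_lt_pi (by positivity) ?_
    rw [mul_div_assoc', div_lt_iff₀ hmR, mul_comm]
    exact mul_lt_mul_of_pos_left (by exact_mod_cast hk') Real.pi_pos

theorem sineRatio_two_mul {m : ℕ} (hm : 2 ≤ m) :
    sineRatio (Real.cos (Real.pi / m)) (2 * m) = 0 := by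
  have hs := sin_pi_div_pos hm
  have h := sineRatio_mul_sin (Real.pi / m) (2 * m)
  have hm0 : (m : ℝ) ≠ 0 := by norm_cast; omega
  rw [show ((2 * m : ℕ) : ℝ) * (Real.pi / m) = 2 * Real.pi by push_cast; field_simp,
    Real.sin_two_pi] at h
  exact (mul_eq_zero.1 h).resolve_right hs.ne'

theorem sineRatio_two_mul_add_one {m : ℕ} (hm : 2 ≤ m) :
    sineRatio (Real.cos (Real.pi / m)) (2 * m + 1) = 1 := by
  have hs := sin_pi_div_pos hm
  have h := sineRatio_mul_sin (Real.pi / m) (2 * m + 1)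
  have hm0 : (m : ℝ) ≠ 0 := by norm_cast; omega
  rw [show ((2 * m + 1 : ℕ) : ℝ) * (Real.pi / m) = Real.pi / m + 2 * Real.pi by
    push_cast; field_simp; ring, Real.sin_add_two_pi] at h
  exact mul_right_cancel₀ hs.ne' (by rw [h, one_mul])

/-! ### Alternating products -/

/-- The product of the alternating word of length `k` in `i`, `i'` that ends with `i'`. -/
def altProd {B G : Type*} [Monoid G] (r : B → G) : B → B → ℕ → G
  | _, _, 0 => 1
  | i, i', k + 1 => altProd r i' i k * r i'

theorem altProd_two_mul {B G : Type*} [Monoid G] (r : B → G) (i i' : B) (m : ℕ) :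
    altProd r i i' (2 * m) = (r i * r i') ^ m := by
  induction m with
  | zero => simp [altProd]
  | succ m ih =>
    rw [show 2 * (m + 1) = 2 * m + 1 + 1 by ring, altProd, altProd, ih, pow_succ, mul_assoc]

theorem map_alternatingWord {B W G : Type*} [Group W] [Monoid G] {M : CoxeterMatrix B}
    (cs : CoxeterSystem M W) (φ : W →* G) (i i' : B) (k : ℕ) :
    φ (cs.wordProd (CoxeterSystem.alternatingWord i i' k))
      = altProd (fun j => φ (cs.simple j)) i i' k := by
  induction k generalizing i i' with
  | zero => simp [CoxeterSystem.alternatingWord, altProd]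
  | succ k ih =>
    rw [CoxeterSystem.alternatingWord_succ, cs.wordProd_concat, map_mul, ih, altProd]

/-- An element without the right descent `i` splits off a reduced alternating word in `i`, `i'` such
that the remaining factor has neither of the descents `i`, `i'`. -/
theorem exists_alternating_factorization {B W : Type*} [Group W] {M : CoxeterMatrix B}
    (cs : CoxeterSystem M W) (i i' : B) (w : W) (hw : ¬cs.IsRightDescent w i) :
    ∃ (v : W) (k : ℕ), w = v * cs.wordProd (CoxeterSystem.alternatingWord i i' k) ∧
      cs.length w = cs.length v + k ∧ ¬cs.IsRightDescent v i ∧ ¬cs.IsRightDescent v i' := by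
  -- Letters are moved from the right end of `v` to the front of the alternating word as long as `v`
  -- has one of the two descents.
  suffices H : ∀ (N : ℕ) (v : W) (k : ℕ), cs.length v = N →
      w = v * cs.wordProd (CoxeterSystem.alternatingWord i i' k) →
      cs.length w = cs.length v + k →
      ∃ (v : W) (k : ℕ), w = v * cs.wordProd (CoxeterSystem.alternatingWord i i' k) ∧
      cs.length w = cs.length v + k ∧ ¬cs.IsRightDescent v i ∧ ¬cs.IsRightDescent v i' from
    H _ w 0 rfl (by simp [CoxeterSystem.alternatingWord]) rfl
  intro N
  induction N with
  | zero =>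
    intro v k hv h1 h2
    exact ⟨v, k, h1, h2, fun h => by unfold CoxeterSystem.IsRightDescent at h; omega,
      fun h => by unfold CoxeterSystem.IsRightDescent at h; omega⟩
  | succ N ih =>
    intro v k hv h1 h2
    -- the descent that prolongs the alternating word
    have good : cs.IsRightDescent v (if Even k then i' else i) →
        ∃ (v : W) (k : ℕ), w = v * cs.wordProd (CoxeterSystem.alternatingWord i i' k) ∧
        cs.length w = cs.length v + k ∧ ¬cs.IsRightDescent v i ∧ ¬cs.IsRightDescent v i' := by
      intro hd
      rw [cs.isRightDescent_iff] at hd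
      refine ih (v * cs.simple (if Even k then i' else i)) (k + 1) (by omega) ?_ (by omega)
      rw [CoxeterSystem.alternatingWord_succ', cs.wordProd_cons, ← mul_assoc,
        cs.simple_mul_simple_cancel_right, ← h1]
    -- The first letter of the word is not a descent of `v`: cancelling it would make `w` shorter
    -- than the sum of the two lengths. For the empty word this is the hypothesis on `w`.
    have bad : ¬cs.IsRightDescent v (if Even k then i else i') := by
      intro hd
      cases k with
      | zero =>
        rw [CoxeterSystem.alternatingWord, cs.wordProd_nil, mul_one] at h1
        rw [← h1] at hd
        exact hw (by simpa using hd)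
      | succ k =>
        rw [cs.isRightDescent_iff] at hd
        have e1 : (if Even (k + 1) then i else i') = (if Even k then i' else i) := by
          by_cases hk : Even k <;> simp [Nat.even_add_one, hk]
        rw [e1] at hd
        have e2 : w = (v * cs.simple (if Even k then i' else i))
            * cs.wordProd (CoxeterSystem.alternatingWord i i' k) := by
          rw [h1, CoxeterSystem.alternatingWord_succ', cs.wordProd_cons, mul_assoc]
        have e3 := cs.length_mul_le (v * cs.simple (if Even k then i' else i))
          (cs.wordProd (CoxeterSystem.alternatingWord i i' k))
        have e4 := cs.length_wordProd_le (CoxeterSystem.alternatingWord i i' k)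
        rw [← e2] at e3
        rw [CoxeterSystem.length_alternatingWord] at e4
        omega
    by_cases hi : cs.IsRightDescent v i
    · refine good ?_
      by_cases hk : Even k
      · rw [if_pos hk] at bad; exact absurd hi bad
      · rwa [if_neg hk]
    by_cases hi' : cs.IsRightDescent v i'
    · refine good ?_
      by_cases hk : Even k
      · rwa [if_pos hk]
      · rw [if_neg hk] at bad; exact absurd hi' bad
    exact ⟨v, k, h1, h2, hi, hi'⟩

/-! ### The diagram group acts by isometries, and its translates of the open polytope are disjoint
(Tits). -/

namespace CoxeterPolytope

variable (P : CoxeterPolytope n)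

/-- The reflection in the `j`-th facet. -/
noncomputable def facetReflection (j : Fin P.numFacets) : E n ≃ᵃⁱ[ℝ] E n :=
  hyperplaneReflection (P.normal j) (P.offset j)

/-- The distance of a point to the hyperplane of the `j`-th facet, positive inside. -/
noncomputable def slack (j : Fin P.numFacets) (x : E n) : ℝ := P.offset j - ⟪P.normal j, x⟫

theorem facetReflection_apply (j : Fin P.numFacets) (x : E n) :
    P.facetReflection j x = x + (2 * P.slack j x) • P.normal j := by
  rw [facetReflection, reflection_apply (P.norm_normal j), slack]
  module

theorem facetReflection_mul_self (j : Fin P.numFacets) :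
    P.facetReflection j * P.facetReflection j = 1 :=
  reflection_mul_self (P.norm_normal j) _

theorem facetReflection_inv (j : Fin P.numFacets) :
    (P.facetReflection j)⁻¹ = P.facetReflection j :=
  reflection_inv (P.norm_normal j) _

theorem facetReflection_mem (j : Fin P.numFacets) : P.facetReflection j ∈ P.reflectionGroup :=
  Subgroup.subset_closure ⟨j, rfl⟩

theorem slack_facetReflection (i j : Fin P.numFacets) (x : E n) :
    P.slack i (P.facetReflection j x)
      = P.slack i x + 2 * Real.cos (Real.pi / P.diagram i j) * P.slack j x := by
  rw [facetReflection_apply, slack, inner_add_right, inner_smul_right, inner_normal, slack, slack]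
  ring

theorem slack_facetReflection_self (i : Fin P.numFacets) (x : E n) :
    P.slack i (P.facetReflection i x) = -P.slack i x := by
  rw [facetReflection_apply, slack, inner_add_right, inner_smul_right,
    inner_self_of_unit (P.norm_normal i), slack]
  ring

theorem mem_openCarrier_iff (x : E n) : x ∈ P.openCarrier ↔ ∀ j, 0 < P.slack j x :=
  forall_congr' fun _ => sub_pos.symm

theorem mem_carrier_iff (x : E n) : x ∈ P.carrier ↔ ∀ j, 0 ≤ P.slack j x :=
  forall_congr' fun _ => sub_nonneg.symm

/-- The dihedral group of two facets acts on their two slacks by the recursion of `sineRatio`: one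
reflection contributes `2 * cos` times the other slack, the one before it a change of sign. -/
theorem slack_altProd_inv (s t : Fin P.numFacets) (k : ℕ) (y : E n) :
    P.slack s ((altProd P.facetReflection s t k)⁻¹ y)
      = if Even k then sineRatio (Real.cos (Real.pi / P.diagram s t)) (k + 1) * P.slack s y
            + sineRatio (Real.cos (Real.pi / P.diagram s t)) k * P.slack t y
        else sineRatio (Real.cos (Real.pi / P.diagram s t)) k * P.slack s y
            + sineRatio (Real.cos (Real.pi / P.diagram s t)) (k + 1) * P.slack t y := by
  induction k using Nat.strong_induction_on generalizing s t with
  | _ k ih =>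
    match k, ih with
    | 0, _ => simp [altProd, sineRatio]
    | 1, _ =>
      simp [altProd, sineRatio, facetReflection_inv, slack_facetReflection]
    | k + 2, ih =>
      have h1 := ih (k + 1) (by omega) t s
      have h2 := ih k (by omega) s t
      rw [P.diagram.symmetric t s] at h1
      rw [altProd, mul_inv_rev, facetReflection_inv, mul_apply', slack_facetReflection, h1, altProd,
        mul_inv_rev, facetReflection_inv, mul_apply', slack_facetReflection_self, h2]
      have e (l : ℕ) : sineRatio (Real.cos (Real.pi / P.diagram s t)) (l + 2)
          = 2 * Real.cos (Real.pi / P.diagram s t)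
            * sineRatio (Real.cos (Real.pi / P.diagram s t)) (l + 1)
            - sineRatio (Real.cos (Real.pi / P.diagram s t)) l := rfl
      rw [show k + 2 + 1 = k + 1 + 2 by ring, e (k + 1), show k + 1 + 1 = k + 2 by ring, e k]
      by_cases hk : Even k
      · simp only [Nat.even_add_one, hk]; simp; ring
      · simp only [Nat.even_add_one, hk]; simp; ring

/-- A displacement in the span of the two normals vanishes once it is orthogonal to both, which is
how `isLiftable` uses it. -/
theorem altProd_apply_sub_mem (s t : Fin P.numFacets) (k : ℕ) (y : E n) :
    ∃ a b : ℝ, altProd P.facetReflection s t k y - y = a • P.normal s + b • P.normal t := by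
  induction k generalizing s t y with
  | zero => exact ⟨0, 0, by simp [altProd]⟩
  | succ k ih =>
    obtain ⟨a, b, h⟩ := ih t s (P.facetReflection t y)
    refine ⟨b, a + 2 * P.slack t y, ?_⟩
    rw [altProd, mul_apply', sub_eq_iff_eq_add.1 h, facetReflection_apply]
    module

/-- By the values of `sineRatio` at `2 * m` and `2 * m + 1`, the power in the braid relation
preserves both slacks, so its displacement is orthogonal to both normals. A label 0 imposes no
relation. -/
theorem isLiftable : P.diagram.IsLiftable P.facetReflection := by
  intro s t
  rcases eq_or_ne s t with rfl | hst
  · rw [P.diagram.diagonal, pow_one, facetReflection_mul_self]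
  rcases Nat.eq_zero_or_pos (P.diagram s t) with h0 | h0
  · rw [h0, pow_zero]
  have hm : 2 ≤ P.diagram s t := by
    have : P.diagram s t ≠ 1 := P.diagram.off_diagonal s t hst
    omega
  set m := P.diagram s t with hmdef
  set g := (P.facetReflection s * P.facetReflection t) ^ m with hg
  have hinv : g⁻¹ = (P.facetReflection t * P.facetReflection s) ^ m := by
    rw [hg, ← inv_pow, mul_inv_rev, facetReflection_inv, facetReflection_inv]
  have key : ∀ a b : Fin P.numFacets, P.diagram a b = m → ∀ y : E n,
      P.slack a (((P.facetReflection a * P.facetReflection b) ^ m)⁻¹ y) = P.slack a y := by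
    intro a b hab y
    rw [← altProd_two_mul, slack_altProd_inv, if_pos (even_two_mul m), hab,
      sineRatio_two_mul hm, sineRatio_two_mul_add_one hm]
    ring
  have hs : ∀ y, P.slack s (g y) = P.slack s y := by
    intro y
    have := key s t rfl (g y)
    rw [← hg, inv_apply_self'] at this
    exact this.symm
  have ht : ∀ y, P.slack t (g y) = P.slack t y := by
    intro y
    have := key t s (P.diagram.symmetric t s) y
    rw [← hinv, inv_inv] at this
    exact this
  refine AffineIsometryEquiv.ext fun y => ?_
  obtain ⟨a, b, hab⟩ := P.altProd_apply_sub_mem s t (2 * m) y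
  rw [altProd_two_mul, ← hg] at hab
  have h1 : ⟪P.normal s, g y - y⟫ = 0 := by
    have := hs y
    rw [slack, slack] at this
    rw [inner_sub_right]; linarith
  have h2 : ⟪P.normal t, g y - y⟫ = 0 := by
    have := ht y
    rw [slack, slack] at this
    rw [inner_sub_right]; linarith
  have h3 : ⟪g y - y, g y - y⟫ = 0 := by
    nth_rw 1 [hab]
    rw [inner_add_left, inner_smul_left, inner_smul_left, h1, h2]
    simp
  exact sub_eq_zero.1 (inner_self_eq_zero.1 h3)

/-- The action of the abstract Coxeter group of the diagram by isometries. -/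
noncomputable def diagramHom : P.diagram.Group →* (E n ≃ᵃⁱ[ℝ] E n) :=
  P.diagram.toCoxeterSystem.lift ⟨P.facetReflection, P.isLiftable⟩

theorem diagramHom_simple (j : Fin P.numFacets) :
    P.diagramHom (P.diagram.toCoxeterSystem.simple j) = P.facetReflection j :=
  P.diagram.toCoxeterSystem.lift_apply_simple P.isLiftable j

theorem range_diagramHom : P.diagramHom.range = P.reflectionGroup := by
  rw [MonoidHom.range_eq_map, ← P.diagram.toCoxeterSystem.subgroup_closure_range_simple,
    MonoidHom.map_closure, ← Set.range_comp]
  refine congrArg Subgroup.closure (congrArg Set.range (funext fun j => ?_))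
  exact P.diagramHom_simple j

/-- Induction on the length of `w`: split off an alternating word in `j` and a descent `t`. The
remaining factor `v` has neither descent, so both slacks are positive there, and a short dihedral
word combines them with nonnegative coefficients, one of them positive. -/
theorem slack_pos_of_not_isRightDescent (w : P.diagram.Group) (j : Fin P.numFacets)
    (hw : ¬P.diagram.toCoxeterSystem.IsRightDescent w j) {x : E n} (hx : x ∈ P.openCarrier) :
    0 < P.slack j ((P.diagramHom w)⁻¹ x) := by
  set cs := P.diagram.toCoxeterSystem with hcs
  induction hN : cs.length w using Nat.strong_induction_on generalizing w j with
  | _ N ih =>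
    rcases eq_or_ne w 1 with rfl | hw1
    · rw [map_one, inv_one]
      exact (P.mem_openCarrier_iff x).1 hx j
    obtain ⟨t, ht⟩ := cs.exists_rightDescent_of_ne_one hw1
    have hjt : j ≠ t := by rintro rfl; exact hw ht
    obtain ⟨v, k, hwv, hlen, hvj, hvt⟩ := exists_alternating_factorization cs j t w hw
    have hk0 : 0 < k := by
      rcases Nat.eq_zero_or_pos k with rfl | h
      · rw [CoxeterSystem.alternatingWord, cs.wordProd_nil, mul_one] at hwv
        rw [hwv] at ht
        exact absurd ht hvt
      · exact h
    have hpj := ih (cs.length v) (by omega) v j hvj rfl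
    have hpt := ih (cs.length v) (by omega) v t hvt rfl
    -- Since `j` is not a descent of `w`, the word prolonged by `j` is still reduced, so its length
    -- `k + 1` is at most a nonzero label.
    have hkm : P.diagram j t = 0 ∨ k < P.diagram j t := by
      by_contra! hcon
      have h1 : ¬cs.IsReduced (CoxeterSystem.alternatingWord t j (k + 1)) := by
        refine cs.not_isReduced_alternatingWord t j ?_ ?_
        · rw [P.diagram.symmetric t j]; exact hcon.1
        · rw [P.diagram.symmetric t j]; omega
      rw [cs.not_isRightDescent_iff, hwv, mul_assoc, ← cs.wordProd_concat,
        ← CoxeterSystem.alternatingWord_succ, ← hwv] at hw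
      have h2 := cs.length_mul_le v (cs.wordProd (CoxeterSystem.alternatingWord t j (k + 1)))
      have h3 := cs.length_wordProd_le (CoxeterSystem.alternatingWord t j (k + 1))
      rw [CoxeterSystem.length_alternatingWord] at h3
      refine h1 ?_
      rw [CoxeterSystem.IsReduced, CoxeterSystem.length_alternatingWord]
      omega
    have hm1 : P.diagram j t ≠ 1 := P.diagram.off_diagonal j t hjt
    rw [hwv, map_mul, map_alternatingWord, mul_inv_rev, mul_apply']
    simp only [hcs, diagramHom_simple]
    rw [slack_altProd_inv]
    have ha := sineRatio_pos hm1 hk0 hkm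
    have hb := sineRatio_nonneg (k := k + 1) hm1 (by omega)
    split_ifs
    · exact add_pos_of_nonneg_of_pos (mul_nonneg hb hpj.le) (mul_pos ha hpt)
    · exact add_pos_of_pos_of_nonneg (mul_pos ha hpj) (mul_nonneg hb hpt.le)

/-- The images of the interior of a Coxeter polytope under its reflection group are disjoint. -/
theorem eq_one_of_mem_openCarrier {g : E n ≃ᵃⁱ[ℝ] E n} (hg : g ∈ P.reflectionGroup) {x : E n}
    (hx : x ∈ P.openCarrier) (hgx : g x ∈ P.openCarrier) : g = 1 := by
  rw [← range_diagramHom] at hg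
  obtain ⟨w, rfl⟩ := hg
  by_contra hne
  have hw1 : w ≠ 1 := by rintro rfl; exact hne (map_one _)
  set cs := P.diagram.toCoxeterSystem with hcs
  obtain ⟨j, hj⟩ := cs.exists_rightDescent_of_ne_one hw1
  have h1 := P.slack_pos_of_not_isRightDescent _ j
    ((cs.isRightDescent_iff_not_isRightDescent_mul).1 hj) hgx
  rw [map_mul, hcs, diagramHom_simple, mul_inv_rev, mul_apply', inv_apply_self',
    facetReflection_inv, slack_facetReflection_self] at h1
  have h2 := (P.mem_openCarrier_iff x).1 hx j
  linarith

end CoxeterPolytope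

/-! ### Proper discontinuity and the polytope as a fundamental domain. -/

theorem finite_of_separated {S : Set (E n)} (hS : Bornology.IsBounded S) {ε : ℝ} (hε : 0 < ε)
    (hsep : ∀ x ∈ S, ∀ y ∈ S, dist x y < ε → x = y) : S.Finite := by
  have htb : TotallyBounded S := (hS.isCompact_closure.totallyBounded).subset subset_closure
  obtain ⟨t, ht, hcov⟩ := Metric.totallyBounded_iff.1 htb (ε / 2) (half_pos hε)
  choose! f hf using fun x (hx : x ∈ S) => Set.mem_iUnion₂.1 (hcov hx)
  refine Set.Finite.of_finite_image (f := f) (ht.subset ?_) ?_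
  · rintro _ ⟨x, hx, rfl⟩
    exact (hf x hx).1
  · intro x hx y hy hxy
    refine hsep x hx y hy ?_
    have h1 := Metric.mem_ball.1 (hf x hx).2
    have h2 := Metric.mem_ball.1 (hf y hy).2
    rw [← hxy, dist_comm] at h2
    linarith [dist_triangle x (f x) y]

namespace CoxeterPolytope

variable (P : CoxeterPolytope n)

/-- The reflection group acts properly discontinuously. -/
theorem finite_setOf_dist_le (x y : E n) (r : ℝ) :
    {g | g ∈ P.reflectionGroup ∧ dist (g x) y ≤ r}.Finite := by
  obtain ⟨p, hp⟩ := P.exists_interior_point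
  obtain ⟨ε, hε, hball⟩ := Metric.isOpen_iff.1 P.isOpen_openCarrier p hp
  set A := {g | g ∈ P.reflectionGroup ∧ dist (g x) y ≤ r} with hA
  -- The orbit of `p` is `ε`-separated: if `g p` and `h p` are closer, then `h⁻¹ * g` sends `p` into
  -- the open polytope.
  have hclose : ∀ g ∈ A, ∀ h ∈ A, dist (g p) (h p) < ε → g = h := by
    intro g hg h hh hd
    have h1 : (h⁻¹ * g) p ∈ P.openCarrier := by
      refine hball ?_
      rw [Metric.mem_ball, mul_apply']
      have h2 : dist (h (h⁻¹ (g p))) (h p) = dist (h⁻¹ (g p)) p := h.dist_map _ _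
      rw [apply_inv_self'] at h2
      rwa [← h2]
    have h3 := P.eq_one_of_mem_openCarrier
      (P.reflectionGroup.mul_mem (P.reflectionGroup.inv_mem hh.1) hg.1) hp h1
    exact (inv_mul_eq_one.1 h3).symm
  refine Set.Finite.of_finite_image (f := fun g => g p) ?_ ?_
  · refine finite_of_separated ?_ hε ?_
    · refine (Metric.isBounded_iff_subset_closedBall y).2 ⟨dist p x + r, ?_⟩
      rintro _ ⟨g, hg, rfl⟩
      rw [Metric.mem_closedBall]
      have h1 := dist_triangle (g p) (g x) y
      rw [g.dist_map] at h1
      linarith [hg.2]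
    · rintro _ ⟨g, hg, rfl⟩ _ ⟨h, hh, rfl⟩ hd
      rw [hclose g hg h hh hd]
  · intro g hg h hh hgh
    exact hclose g hg h hh (by rw [show g p = h p from hgh, dist_self]; exact hε)

theorem dist_facetReflection_lt {j : Fin P.numFacets} {p y : E n} (hp : 0 < P.slack j p)
    (hy : P.slack j y < 0) : dist (P.facetReflection j y) p < dist y p := by
  rw [dist_eq_norm, dist_eq_norm]
  refine lt_of_pow_lt_pow_left₀ 2 (norm_nonneg _) ?_
  rw [facetReflection_apply, show y + (2 * P.slack j y) • P.normal j - p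
    = (y - p) + (2 * P.slack j y) • P.normal j by abel, norm_add_sq_real, norm_smul,
    P.norm_normal, inner_smul_right, real_inner_comm, inner_sub_right, mul_one,
    Real.norm_eq_abs, sq_abs]
  have h1 : ⟪P.normal j, y⟫ - ⟪P.normal j, p⟫ = P.slack j p - P.slack j y := by
    rw [slack, slack]; ring
  rw [h1]
  nlinarith [mul_neg_of_neg_of_pos hy hp]

/-- An element of the subgroup that brings `x` closest to an interior point works, as reflecting in
a violated facet would bring it still closer. The set `J` is everything for the whole group, and the
facets through a point for its stabilizer. -/
theorem exists_mem_slack_nonneg (J : Set (Fin P.numFacets)) (x : E n) :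
    ∃ g ∈ Subgroup.closure (P.facetReflection '' J), ∀ j ∈ J, 0 ≤ P.slack j (g x) := by
  obtain ⟨p, hp⟩ := P.exists_interior_point
  set K := Subgroup.closure (P.facetReflection '' J) with hK
  have hKG : K ≤ P.reflectionGroup := by
    rw [hK, Subgroup.closure_le]
    rintro _ ⟨j, -, rfl⟩
    exact P.facetReflection_mem j
  have hfin : {g | g ∈ K ∧ dist (g x) p ≤ dist x p}.Finite :=
    (P.finite_setOf_dist_le x p (dist x p)).subset fun g hg => ⟨hKG hg.1, hg.2⟩
  obtain ⟨g, hg, hmin⟩ := Set.exists_min_image _ (fun g => dist (g x) p) hfin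
    ⟨1, one_mem K, le_refl _⟩
  refine ⟨g, hg.1, fun j hj => ?_⟩
  by_contra! hneg
  have h1 := P.dist_facetReflection_lt ((P.mem_openCarrier_iff p).1 hp j) hneg
  have h2 : P.facetReflection j * g ∈ K :=
    K.mul_mem (Subgroup.subset_closure ⟨j, hj, rfl⟩) hg.1
  have h3 := hmin _ ⟨h2, by rw [mul_apply']; exact h1.le.trans hg.2⟩
  rw [mul_apply'] at h3
  linarith

/-- Every orbit of the reflection group meets the polytope. -/
theorem exists_map_mem_carrier (x : E n) : ∃ g ∈ P.reflectionGroup, g x ∈ P.carrier := by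
  obtain ⟨g, hg, h⟩ := P.exists_mem_slack_nonneg Set.univ x
  refine ⟨g, ?_, (P.mem_carrier_iff _).2 fun j => h j trivial⟩
  rw [Set.image_univ] at hg
  exact hg

/-- A small push of `g x` towards an interior point makes it interior, while its preimage stays
interior. -/
theorem eq_one_of_mem_carrier {g : E n ≃ᵃⁱ[ℝ] E n} (hg : g ∈ P.reflectionGroup) {x : E n}
    (hx : x ∈ P.openCarrier) (hgx : g x ∈ P.carrier) : g = 1 := by
  obtain ⟨p, hp⟩ := P.exists_interior_point
  have hcont : Continuous fun t : ℝ => g⁻¹ (g x + t • (p - g x)) :=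
    g⁻¹.continuous.comp (by fun_prop)
  have h0 : (fun t : ℝ => g⁻¹ (g x + t • (p - g x))) 0 ∈ P.openCarrier := by
    simpa [-AffineIsometryEquiv.coe_inv, inv_apply_self'] using hx
  have hnhds := hcont.continuousAt.eventually_mem (P.isOpen_openCarrier.mem_nhds h0)
  have h1 : ∀ᶠ t : ℝ in nhdsWithin 0 (Set.Ioi 0), t ∈ Set.Ioc (0 : ℝ) 1 := Ioc_mem_nhdsGT one_pos
  obtain ⟨t, ht, ht'⟩ := ((hnhds.filter_mono nhdsWithin_le_nhds).and h1).exists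
  refine P.eq_one_of_mem_openCarrier hg ht ?_
  rw [apply_inv_self']
  exact P.segment_mem_openCarrier hgx hp ht'.1 ht'.2

/-- The stabilizer of a point of the polytope is generated by the reflections in the facets through
that point. -/
theorem mem_closure_of_map_eq {V : E n} (hV : V ∈ P.carrier) {g : E n ≃ᵃⁱ[ℝ] E n}
    (hg : g ∈ P.reflectionGroup) (hgV : g V = V) :
    g ∈ Subgroup.closure (P.facetReflection '' {j | P.slack j V = 0}) := by
  obtain ⟨p, hp⟩ := P.exists_interior_point
  -- The element `u` brings `g p` back into the cone of `P` at `V`. Then `u * g` fixes `V` and sends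
  -- points near `V` on the segment to `p` into `P`, hence is the identity.
  obtain ⟨u, hu, hslack⟩ := P.exists_mem_slack_nonneg {j | P.slack j V = 0} (g p)
  set K := Subgroup.closure (P.facetReflection '' {j | P.slack j V = 0}) with hK
  have hKG : K ≤ P.reflectionGroup := by
    rw [hK, Subgroup.closure_le]
    rintro _ ⟨j, -, rfl⟩
    exact P.facetReflection_mem j
  have hKV : ∀ k ∈ K, k V = V := by
    intro k hk
    induction hk using Subgroup.closure_induction with
    | mem x hx =>
      obtain ⟨j, hj, rfl⟩ := hx
      rw [facetReflection_apply, show P.slack j V = 0 from hj]; simp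
    | one => rfl
    | mul a b _ _ ha hb => rw [mul_apply', hb, ha]
    | inv a _ ha => nth_rw 1 [← ha]; exact inv_apply_self' _ _
  have hugV : (u * g) V = V := by rw [mul_apply', hgV, hKV u hu]
  have hline : ∀ j (t : ℝ), P.slack j (V + t • ((u * g) p - V))
      = (1 - t) * P.slack j V + t * P.slack j ((u * g) p) := by
    intro j t
    rw [slack, slack, slack, inner_add_right, inner_smul_right, inner_sub_right]; ring
  have hev : ∀ᶠ t : ℝ in nhdsWithin 0 (Set.Ioi 0),
      ∀ j, 0 ≤ P.slack j (V + t • ((u * g) p - V)) := by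
    refine Filter.eventually_all.2 fun j => ?_
    by_cases hj : P.slack j V = 0
    · refine Filter.eventually_of_mem self_mem_nhdsWithin fun t (ht : 0 < t) => ?_
      rw [hline, hj, mul_zero, zero_add]
      exact mul_nonneg ht.le (hslack j hj)
    · have hpos : 0 < P.slack j V := lt_of_le_of_ne ((P.mem_carrier_iff V).1 hV j) (Ne.symm hj)
      have hc : Continuous fun t : ℝ => P.slack j (V + t • ((u * g) p - V)) := by
        simp only [slack]; fun_prop
      have : ∀ᶠ t : ℝ in nhds 0, 0 < P.slack j (V + t • ((u * g) p - V)) := by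
        refine hc.continuousAt.eventually (lt_mem_nhds ?_)
        simpa using hpos
      exact (this.filter_mono nhdsWithin_le_nhds).mono fun t ht => ht.le
  have h1 : ∀ᶠ t : ℝ in nhdsWithin 0 (Set.Ioi 0), t ∈ Set.Ioc (0 : ℝ) 1 := Ioc_mem_nhdsGT one_pos
  obtain ⟨t, ht, ht'⟩ := (hev.and h1).exists
  have h2 : u * g = 1 := by
    refine P.eq_one_of_mem_carrier (P.reflectionGroup.mul_mem (hKG hu) hg)
      (P.segment_mem_openCarrier hV hp ht'.1 ht'.2) ((P.mem_carrier_iff _).2 fun j => ?_)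
    have h3 : (u * g) (V + t • (p - V)) = V + t • ((u * g) p - V) := by
      rw [map_add_eq, map_smul, hugV, ← map_sub_map, hugV]
    rw [h3]
    exact ht j
  rw [← inv_eq_of_mul_eq_one_right h2]
  exact K.inv_mem hu

/-- No mirror of the reflection group cuts the polytope. -/
theorem carrier_le_or_ge {u : E n} (hu : ‖u‖ = 1) {b : ℝ}
    (hr : hyperplaneReflection u b ∈ P.reflectionGroup) :
    (∀ x ∈ P.carrier, ⟪u, x⟫ ≤ b) ∨ (∀ x ∈ P.carrier, b ≤ ⟪u, x⟫) := by
  have hne : ∀ x ∈ P.openCarrier, ⟪u, x⟫ ≠ b := by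
    intro x hx hxb
    refine reflection_ne_one hu b (P.eq_one_of_mem_openCarrier hr hx ?_)
    rwa [(reflection_fixed hu).2 hxb]
  obtain ⟨p, hp⟩ := P.exists_interior_point
  -- If `x` and the interior point `p` were on opposite sides, the segment between them would meet
  -- the mirror, at parameter `s / (s - q)`, in an interior point.
  have key : ∀ x ∈ P.carrier, (⟪u, x⟫ - b) * (⟪u, p⟫ - b) < 0 → False := by
    intro x hx hlt
    set s := ⟪u, x⟫ - b with hs
    set q := ⟪u, p⟫ - b with hq
    have hsq : s - q ≠ 0 := fun h => by
      rw [sub_eq_zero.1 h] at hlt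
      exact absurd hlt (not_lt.2 (mul_self_nonneg q))
    have ht : 0 < s / (s - q) ∧ s / (s - q) ≤ 1 := by
      rcases lt_or_gt_of_ne hsq with h | h
      · have : s < 0 := by nlinarith
        exact ⟨div_pos_of_neg_of_neg this h, by rw [div_le_one_of_neg h]; nlinarith⟩
      · have : 0 < s := by nlinarith
        exact ⟨div_pos this h, by rw [div_le_one h]; nlinarith⟩
    refine hne _ (P.segment_mem_openCarrier hx hp ht.1 ht.2) ?_
    rw [inner_add_right, inner_smul_right, inner_sub_right,
      show ⟪u, p⟫ = q + b by rw [hq]; ring, show ⟪u, x⟫ = s + b by rw [hs]; ring]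
    field_simp
    ring
  rcases lt_or_gt_of_ne (hne p hp) with h | h
  · left
    intro x hx
    by_contra! hlt
    exact key x hx (mul_neg_of_pos_of_neg (by linarith) (by linarith))
  · right
    intro x hx
    by_contra! hlt
    exact key x hx (mul_neg_of_neg_of_pos (by linarith) (by linarith))

end CoxeterPolytope

/-! ### Nonobtuse families and simple systems -/

/-- The diagonal terms vanish because positive and negative part are never both nonzero. -/
theorem inner_sum_posPart_sum_negPart_nonpos {ι : Type*} [Fintype ι] {β : ι → E n}
    (hβ : ∀ i j, i ≠ j → ⟪β i, β j⟫ ≤ 0) (c : ι → ℝ) :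
    ⟪∑ i, (c i)⁺ • β i, ∑ i, (c i)⁻ • β i⟫ ≤ 0 := by
  rw [sum_inner]
  refine Finset.sum_nonpos fun i _ => ?_
  rw [inner_sum]
  refine Finset.sum_nonpos fun j _ => ?_
  rw [inner_smul_left, inner_smul_right]
  simp only [conj_trivial]
  rcases eq_or_ne i j with rfl | hij
  · rcases le_total 0 (c i) with h | h
    · rw [negPart_eq_zero.2 h]; simp
    · rw [posPart_eq_zero.2 h]; simp
  · exact mul_nonpos_of_nonneg_of_nonpos (posPart_nonneg _)
      (mul_nonpos_of_nonneg_of_nonpos (negPart_nonneg _) (hβ i j hij))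

/-- Separating the signs in a relation gives a vector with nonpositive square. Both halves are
therefore zero, and pairing them with `q` kills every coefficient. -/
theorem linearIndependent_of_inner_nonpos {ι : Type*} [Fintype ι] {β : ι → E n}
    (hβ : ∀ i j, i ≠ j → ⟪β i, β j⟫ ≤ 0) {q : E n} (hq : ∀ i, 0 < ⟪β i, q⟫) :
    LinearIndependent ℝ β := by
  rw [Fintype.linearIndependent_iff]
  intro c hc
  set p := ∑ i, (c i)⁺ • β i with hp
  set m := ∑ i, (c i)⁻ • β i with hm
  have hpm : p = m := by
    rw [← sub_eq_zero, hp, hm, ← Finset.sum_sub_distrib, ← hc]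
    refine Finset.sum_congr rfl fun i _ => ?_
    rw [← sub_smul, posPart_sub_negPart]
  have h1 : ⟪p, m⟫ ≤ 0 := inner_sum_posPart_sum_negPart_nonpos hβ c
  have hp0 : p = 0 := by
    rw [← hpm] at h1
    exact inner_self_eq_zero.1 (le_antisymm h1 real_inner_self_nonneg)
  have key : ∀ a : ι → ℝ, (∀ i, 0 ≤ a i) → ∑ i, a i • β i = 0 → ∀ i, a i = 0 := by
    intro a ha h0 i
    have h2 : ∑ i, a i * ⟪β i, q⟫ = 0 := by
      have := congrArg (fun z => ⟪z, q⟫) h0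
      simpa [sum_inner, inner_smul_left] using this
    have h3 := (Finset.sum_eq_zero_iff_of_nonneg
      (fun i _ => mul_nonneg (ha i) (hq i).le)).1 h2 i (Finset.mem_univ _)
    exact (mul_eq_zero.1 h3).resolve_right (hq i).ne'
  intro i
  rw [← posPart_sub_negPart (c i), key _ (fun i => posPart_nonneg (c i)) hp0 i,
    key _ (fun i => negPart_nonneg (c i)) (by rw [← hm, ← hpm, hp0]) i, sub_zero]

theorem exists_inner_eq {ι : Type*} {β : ι → E n} (hβ : LinearIndependent ℝ β) (c : ι → ℝ) :
    ∃ x : E n, ∀ i, ⟪β i, x⟫ = c i := by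
  obtain ⟨f, hf⟩ : ∃ f : E n →ₗ[ℝ] ℝ, ∀ i, f (β i) = c i := by
    let b := Module.Basis.span hβ
    obtain ⟨f, hf⟩ := LinearMap.exists_extend (b.constr ℝ c)
    refine ⟨f, fun i => ?_⟩
    have h1 : (b i : E n) = β i := congrArg Subtype.val (Module.Basis.span_apply hβ i)
    rw [← h1, ← Submodule.subtype_apply, ← LinearMap.comp_apply, hf, Module.Basis.constr_basis]
  refine ⟨(InnerProductSpace.toDual ℝ (E n)).symm (LinearMap.toContinuousLinearMap f), fun i => ?_⟩
  rw [real_inner_comm, InnerProductSpace.toDual_symm_apply]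
  exact hf i

theorem exists_inner_ne_zero {R : Set (E n)} (hR : R.Finite) (hR0 : ∀ r ∈ R, r ≠ 0) :
    ∃ v : E n, ∀ r ∈ R, ⟪v, r⟫ ≠ 0 := by
  have h := Subspace.biUnion_ne_univ_of_top_notMem (k := ℝ) (E := E n)
    (s := (hR.toFinset.image fun r => (Submodule.span ℝ {r})ᗮ)) (by
      intro h
      obtain ⟨r, hr, hr'⟩ := Finset.mem_image.1 h
      rw [Submodule.orthogonal_eq_top_iff, Submodule.span_singleton_eq_bot] at hr'
      exact hR0 r (hR.mem_toFinset.1 hr) hr')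
  obtain ⟨v, hv⟩ := (Set.ne_univ_iff_exists_notMem _).1 h
  refine ⟨v, fun r hr h0 => hv ?_⟩
  refine Set.mem_biUnion (x := (Submodule.span ℝ {r})ᗮ) ?_ ?_
  · exact Finset.mem_coe.2 (Finset.mem_image.2 ⟨r, hR.mem_toFinset.2 hr, rfl⟩)
  · rw [SetLike.mem_coe, Submodule.mem_orthogonal_singleton_iff_inner_left]; exact h0

/-- A finite set of unit vectors that is stable under the reflections in its members has a simple
system: a linearly independent subset whose reflections generate all the others. -/
theorem exists_simpleSystem {R : Set (E n)} (hR : R.Finite) (hunit : ∀ r ∈ R, ‖r‖ = 1)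
    (hrefl : ∀ r ∈ R, ∀ s ∈ R, s - (2 * ⟪r, s⟫) • r ∈ R) :
    ∃ S : Finset (E n), (S : Set (E n)) ⊆ R ∧ LinearIndependent ℝ (fun s : S => (s : E n)) ∧
      ∀ K : Subgroup (E n ≃ₗᵢ[ℝ] E n), (∀ s ∈ S, linHom (hyperplaneReflection s 0) ∈ K) →
        ∀ r ∈ R, linHom (hyperplaneReflection r 0) ∈ K := by
  classical
  have hneg : ∀ r ∈ R, -r ∈ R := by
    intro r hr
    have := hrefl r hr r hr
    rw [inner_self_of_unit (hunit r hr)] at this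
    convert this using 1
    module
  obtain ⟨v, hv⟩ := exists_inner_ne_zero hR
    (fun r hr h0 => by have := hunit r hr; rw [h0, norm_zero] at this; exact zero_ne_one this)
  set pos : Finset (E n) := hR.toFinset.filter fun r => 0 < ⟪v, r⟫ with hposdef
  have mem_pos : ∀ r, r ∈ pos ↔ r ∈ R ∧ 0 < ⟪v, r⟫ := by
    intro r; rw [hposdef, Finset.mem_filter, hR.mem_toFinset]
  have pos_or : ∀ r ∈ R, r ∈ pos ∨ -r ∈ pos := by
    intro r hr
    rcases lt_or_gt_of_ne (hv r hr) with h | h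
    · right; exact (mem_pos _).2 ⟨hneg r hr, by rw [inner_neg_right]; linarith⟩
    · left; exact (mem_pos _).2 ⟨hr, h⟩
  -- `S` is a minimal generating set of the cone of positive roots
  let Gen : Finset (E n) → Prop := fun S =>
    S ⊆ pos ∧ ∀ r ∈ pos, ∃ a : E n → ℝ, (∀ s, 0 ≤ a s) ∧ r = ∑ s ∈ S, a s • s
  have hex : ∃ S, Gen S := by
    refine ⟨pos, subset_rfl, fun r hr => ⟨fun s => if s = r then 1 else 0, fun s => ?_, ?_⟩⟩
    · dsimp only; split_ifs <;> norm_num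
    · simp [hr]
  obtain ⟨S, hS, hSmin⟩ : ∃ S, Gen S ∧ ∀ T, Gen T → S.card ≤ T.card := by
    obtain ⟨S, hS, hmin⟩ := (measure (Finset.card (α := E n))).wf.has_min {S | Gen S} hex
    exact ⟨S, hS, fun T hT => not_lt.1 (hmin T hT)⟩
  obtain ⟨hSpos, hSgen⟩ := hS
  -- If `x` used another generator with positive weight, solving for `x` would make it superfluous,
  -- against minimality. Pairing with `v` shows that the coefficient of `x` on the right is below 1.
  have irred : ∀ x ∈ S, ∀ y ∈ S, x ≠ y → ∀ (c : ℝ) (a : E n → ℝ), 0 < c → (∀ s, 0 ≤ a s) →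
      x = c • y + ∑ s ∈ S, a s • s → False := by
    intro x hx y hy hxy c a hc ha hxeq
    rw [← Finset.add_sum_erase S _ hx] at hxeq
    have hpv : ∀ s ∈ S, 0 < ⟪v, s⟫ := fun s hs => ((mem_pos s).1 (hSpos hs)).2
    have hsum : 0 ≤ ⟪v, ∑ s ∈ S.erase x, a s • s⟫ := by
      rw [inner_sum]
      refine Finset.sum_nonneg fun s hs => ?_
      rw [inner_smul_right]
      exact mul_nonneg (ha s) (hpv s (Finset.mem_of_mem_erase hs)).le
    have h1 : a x < 1 := by
      by_contra! h1
      have := congrArg (fun z => ⟪v, z⟫) hxeq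
      simp only [inner_add_right, inner_smul_right] at this
      nlinarith [mul_pos hc (hpv y hy), hpv x hx]
    have h2 : x = ∑ s ∈ S.erase x, ((1 - a x)⁻¹ * (a s + if s = y then c else 0)) • s := by
      have h3 : (1 - a x) • x = ∑ s ∈ S.erase x, (a s + if s = y then c else 0) • s := by
        simp only [add_smul, Finset.sum_add_distrib, ite_smul, zero_smul, Finset.sum_ite_eq',
          Finset.mem_erase, hy, Ne.symm hxy, ne_eq, not_false_eq_true, and_self, if_true]
        rw [sub_smul, one_smul]
        nth_rw 1 [hxeq]
        abel
      simp only [mul_smul]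
      rw [← Finset.smul_sum, ← h3, smul_smul, inv_mul_cancel₀ (by linarith), one_smul]
    set d : E n → ℝ := fun s => (1 - a x)⁻¹ * (a s + if s = y then c else 0) with hd
    have hd0 : ∀ s, 0 ≤ d s := by
      intro s
      refine mul_nonneg (inv_nonneg.2 (by linarith)) (add_nonneg (ha s) ?_)
      split_ifs <;> linarith
    have hG : Gen (S.erase x) := by
      refine ⟨(Finset.erase_subset _ _).trans hSpos, fun r hr => ?_⟩
      obtain ⟨e, he, hre⟩ := hSgen r hr
      refine ⟨fun s => e s + e x * d s, fun s => add_nonneg (he s) (mul_nonneg (he x) (hd0 s)), ?_⟩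
      simp only [add_smul, mul_smul, Finset.sum_add_distrib]
      rw [← Finset.smul_sum, ← h2, add_comm, Finset.add_sum_erase S (fun s => e s • s) hx]
      exact hre
    have := hSmin _ hG
    rw [Finset.card_erase_of_mem hx] at this
    have := Finset.card_pos.2 ⟨x, hx⟩
    omega
  have hSR : ∀ s ∈ S, s ∈ R := fun s hs => ((mem_pos s).1 (hSpos hs)).1
  -- For a positive product, the reflected root or its negative is a positive root. In either case
  -- one of `x`, `y` gets an expression that `irred` forbids.
  have obtuse : ∀ x ∈ S, ∀ y ∈ S, x ≠ y → ⟪x, y⟫ ≤ 0 := by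
    intro x hx y hy hxy
    by_contra! hpos
    have hc : 0 < 2 * ⟪x, y⟫ := by linarith
    rcases pos_or _ (hrefl x (hSR x hx) y (hSR y hy)) with h | h
    · obtain ⟨a, ha, hay⟩ := hSgen _ h
      refine irred y hy x hx (Ne.symm hxy) _ a hc ha ?_
      rw [← hay]; abel
    · obtain ⟨a, ha, hay⟩ := hSgen _ h
      refine irred x hx y hy hxy (2 * ⟪x, y⟫)⁻¹ (fun s => (2 * ⟪x, y⟫)⁻¹ * a s) (inv_pos.2 hc)
        (fun s => mul_nonneg (inv_nonneg.2 hc.le) (ha s)) ?_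
      simp only [mul_smul (2 * ⟪x, y⟫)⁻¹ (a _)]
      rw [← Finset.smul_sum, ← hay, ← smul_add, neg_sub, add_sub_cancel, smul_smul,
        inv_mul_cancel₀ hc.ne', one_smul]
  refine ⟨S, hSR, ?_, ?_⟩
  · refine linearIndependent_of_inner_nonpos (q := v) ?_ ?_
    · intro i j hij
      exact obtuse _ i.2 _ j.2 fun h => hij (Subtype.ext h)
    · intro i
      rw [real_inner_comm]
      exact ((mem_pos _).1 (hSpos i.2)).2
  · intro K hK
    -- Take a counterexample `r` of least height `⟪v, r⟫`. Some simple `s` has positive product with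
    -- it, and reflecting in `s` lowers the height; the new root is positive unless `r = s`.
    have hposK : ∀ r ∈ pos, linHom (hyperplaneReflection r 0) ∈ K := by
      by_contra! hcon
      obtain ⟨r0, hr0, hr0K⟩ := hcon
      obtain ⟨r, hr, hmin⟩ := Finset.exists_min_image
        (pos.filter fun r => linHom (hyperplaneReflection r 0) ∉ K) (fun r => ⟪v, r⟫)
        ⟨r0, Finset.mem_filter.2 ⟨hr0, hr0K⟩⟩
      obtain ⟨hrp, hrK⟩ := Finset.mem_filter.1 hr
      have hrR := ((mem_pos r).1 hrp).1
      obtain ⟨a, ha, hra⟩ := hSgen r hrp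
      obtain ⟨s, hs, hsr⟩ : ∃ s ∈ S, 0 < ⟪s, r⟫ := by
        by_contra! hle
        have h1 : ⟪r, r⟫ ≤ 0 := by
          nth_rw 1 [hra]
          rw [sum_inner]
          refine Finset.sum_nonpos fun s hs => ?_
          rw [inner_smul_left]
          exact mul_nonpos_of_nonneg_of_nonpos (ha s) (hle s hs)
        rw [inner_self_of_unit (hunit r hrR)] at h1
        linarith
      have hsR := hSR s hs
      have hsu := hunit s hsR
      have hr'R := hrefl s hsR r hrR
      have hvs := ((mem_pos s).1 (hSpos hs)).2
      have heq : linHom (hyperplaneReflection s 0) r = r - (2 * ⟪s, r⟫) • s :=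
        linHom_reflection_apply hsu 0 r
      have hconj : linHom (hyperplaneReflection (r - (2 * ⟪s, r⟫) • s) 0) ∈ K → False := by
        intro hin
        refine hrK ?_
        have h1 := linHom_conj_reflection (linHom (hyperplaneReflection s 0)) (hunit r hrR) 0 0
        rw [heq] at h1
        rw [← h1] at hin
        have h2 := K.mul_mem (K.mul_mem (K.inv_mem (hK s hs)) hin) (hK s hs)
        simpa [mul_assoc] using h2
      have hrp' : r - (2 * ⟪s, r⟫) • s ∈ pos := by
        rcases pos_or _ hr'R with h | h
        · exact h
        · exfalso
          -- `c s = r + (nonnegative combination)`, so `r` is a multiple of `s`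
          obtain ⟨e, he, hre⟩ := hSgen _ h
          have hcs : (2 * ⟪s, r⟫) • s = ∑ t ∈ S, (a t + e t) • t := by
            simp only [add_smul, Finset.sum_add_distrib]
            rw [← hra, ← hre]; abel
          have hot : ∀ t ∈ S, t ≠ s → a t = 0 := by
            intro t ht hts
            by_contra hat
            have hatpos : 0 < a t := lt_of_le_of_ne (ha t) (Ne.symm hat)
            refine irred s hs t ht (Ne.symm hts) ((2 * ⟪s, r⟫)⁻¹ * a t)
              (fun w => (2 * ⟪s, r⟫)⁻¹ * (if w = t then e w else a w + e w)) (by positivity)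
              (fun w => mul_nonneg (by positivity) ?_) ?_
            · split_ifs
              · exact he w
              · exact add_nonneg (ha w) (he w)
            · simp only [mul_smul (2 * ⟪s, r⟫)⁻¹]
              rw [← Finset.smul_sum, ← smul_add]
              have : a t • t + ∑ w ∈ S, (if w = t then e w else a w + e w) • w
                  = ∑ w ∈ S, (a w + e w) • w := by
                rw [← Finset.add_sum_erase S _ ht,
                  ← Finset.add_sum_erase S (fun w => (a w + e w) • w) ht, if_pos rfl, ← add_assoc, ← add_smul]
                congr 1
                refine Finset.sum_congr rfl fun w hw => ?_
                rw [if_neg (Finset.ne_of_mem_erase hw)]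
              rw [this, ← hcs, smul_smul, inv_mul_cancel₀ (by positivity), one_smul]
          have hrs : r = a s • s := by
            rw [← Finset.add_sum_erase S _ hs, Finset.sum_eq_zero, add_zero] at hra
            · exact hra
            · intro t ht
              rw [hot t (Finset.mem_of_mem_erase ht) (Finset.ne_of_mem_erase ht), zero_smul]
          have has : a s = 1 := by
            have := hunit r hrR
            rw [hrs, norm_smul, hsu, mul_one, Real.norm_of_nonneg (ha s)] at this
            exact this
          rw [has, one_smul] at hrs
          exact hrK (hrs ▸ hK s hs)
      have h3 := hmin _ (Finset.mem_filter.2 ⟨hrp', fun h => hconj h⟩)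
      rw [inner_sub_right, inner_smul_right] at h3
      nlinarith [mul_pos hsr hvs]
    intro r hr
    rcases pos_or r hr with h | h
    · exact hposK r h
    · have := hposK _ h
      have h1 := reflection_neg (hunit r hr) 0
      rw [neg_zero] at h1
      rwa [h1] at this

/-! ### Mirror directions and the existence of special vertices. -/

namespace CoxeterPolytope

variable (P : CoxeterPolytope n)

/-- The unit normals of the mirrors of the reflection group. -/
def mirrorNormals : Set (E n) :=
  {u | ‖u‖ = 1 ∧ ∃ b, hyperplaneReflection u b ∈ P.reflectionGroup}

theorem normal_mem_mirrorNormals (j : Fin P.numFacets) : P.normal j ∈ P.mirrorNormals :=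
  ⟨P.norm_normal j, P.offset j, P.facetReflection_mem j⟩

theorem linHom_mem_mirrorNormals {g : E n ≃ᵃⁱ[ℝ] E n} (hg : g ∈ P.reflectionGroup) {u : E n}
    (hu : u ∈ P.mirrorNormals) : linHom g u ∈ P.mirrorNormals := by
  obtain ⟨hu1, b, hb⟩ := hu
  refine ⟨norm_linHom _ hu1, b + ⟪linHom g u, g 0⟫, ?_⟩
  rw [← reflection_conj g hu1]
  exact P.reflectionGroup.mul_mem (P.reflectionGroup.mul_mem hg hb) (P.reflectionGroup.inv_mem hg)

theorem reflect_mem_mirrorNormals {u v : E n} (hu : u ∈ P.mirrorNormals)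
    (hv : v ∈ P.mirrorNormals) : v - (2 * ⟪u, v⟫) • u ∈ P.mirrorNormals := by
  obtain ⟨hu1, b, hb⟩ := hu
  rw [← linHom_reflection_apply hu1 b]
  exact P.linHom_mem_mirrorNormals hb hv

/-- An element with a fixed point in the bounded polytope moves an interior point by a bounded
distance. -/
theorem finite_fixing_carrier :
    {g | g ∈ P.reflectionGroup ∧ ∃ y ∈ P.carrier, g y = y}.Finite := by
  obtain ⟨p, hp⟩ := P.exists_interior_point
  obtain ⟨C, hC⟩ := (Metric.isBounded_iff_subset_closedBall p).1 P.isBounded_carrier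
  refine (P.finite_setOf_dist_le p p (C + C)).subset ?_
  rintro g ⟨hg, y, hy, hgy⟩
  refine ⟨hg, ?_⟩
  have h1 := dist_triangle (g p) (g y) p
  have h2 := Metric.mem_closedBall.1 (hC hy)
  rw [g.dist_map, hgy, dist_comm p y] at h1
  linarith

theorem finite_normals_of_reflection (g : E n ≃ᵃⁱ[ℝ] E n) :
    {u : E n | ‖u‖ = 1 ∧ ∃ b, hyperplaneReflection u b = g}.Finite := by
  rcases Set.eq_empty_or_nonempty {u : E n | ‖u‖ = 1 ∧ ∃ b, hyperplaneReflection u b = g}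
    with h | ⟨u, hu, b, hb⟩
  · rw [h]; exact Set.finite_empty
  · refine (Set.toFinite {u, -u}).subset ?_
    rintro v ⟨hv, c, hc⟩
    exact eq_or_eq_neg_of_linHom_eq hv hu (congrArg linHom (hc.trans hb.symm))

/-- Two mirrors that are not parallel meet, and a group element moves a common point into the
polytope. There only finitely many reflections are left. -/
theorem finite_inner_mirrorNormals :
    {c : ℝ | ∃ u ∈ P.mirrorNormals, ∃ v ∈ P.mirrorNormals, ⟪u, v⟫ = c}.Finite := by
  set A := {g | g ∈ P.reflectionGroup ∧ ∃ y ∈ P.carrier, g y = y} with hA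
  set B := ⋃ g ∈ A, {u : E n | ‖u‖ = 1 ∧ ∃ b, hyperplaneReflection u b = g} with hB
  have hBfin : B.Finite :=
    P.finite_fixing_carrier.biUnion fun g _ => finite_normals_of_reflection g
  refine (((hBfin.prod hBfin).image fun w => ⟪w.1, w.2⟫).union (Set.toFinite {1, -1})).subset ?_
  rintro c ⟨u, hu, v, hv, rfl⟩
  by_cases h1 : u = v
  · right; left; rw [h1, inner_self_of_unit hv.1]
  by_cases h2 : u = -v
  · right; right; rw [h2, inner_neg_left, inner_self_of_unit hv.1]; rfl
  left
  obtain ⟨a, ha⟩ := hu.2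
  obtain ⟨b, hb⟩ := hv.2
  obtain ⟨y, hya, hyb⟩ := exists_inner_eq_and hu.1 hv.1 h1 h2 a b
  obtain ⟨g, hg, hgy⟩ := P.exists_map_mem_carrier y
  have key : ∀ w c, ‖w‖ = 1 → hyperplaneReflection w c ∈ P.reflectionGroup → ⟪w, y⟫ = c →
      linHom g w ∈ B := by
    intro w c hw hwc hwy
    refine Set.mem_iUnion₂.2 ⟨g * hyperplaneReflection w c * g⁻¹, ⟨?_, g y, hgy, ?_⟩,
      norm_linHom _ hw, _, (reflection_conj g hw c).symm⟩
    · exact P.reflectionGroup.mul_mem (P.reflectionGroup.mul_mem hg hwc)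
        (P.reflectionGroup.inv_mem hg)
    · rw [mul_apply', mul_apply', inv_apply_self', (reflection_fixed hw).2 hwy]
  refine ⟨(linHom g u, linHom g v), ⟨key u a hu.1 ha hya, key v b hv.1 hb hyb⟩, ?_⟩
  exact LinearIsometryEquiv.inner_map_map _ _ _

/-- A mirror normal is determined by its products with the facet normals, which take finitely many
values. -/
theorem finite_mirrorNormals : P.mirrorNormals.Finite := by
  refine Set.Finite.of_finite_image (f := fun u j => ⟪P.normal j, u⟫) ?_ ?_
  · refine (Set.Finite.pi fun _ : Fin P.numFacets => P.finite_inner_mirrorNormals).subset ?_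
    rintro _ ⟨u, hu, rfl⟩ j -
    exact ⟨_, P.normal_mem_mirrorNormals j, u, hu, rfl⟩
  · intro u _ v _ huv
    refine sub_eq_zero.1 (P.eq_zero_of_inner_eq_zero fun j => ?_)
    rw [inner_sub_right, sub_eq_zero]
    exact congrFun huv j

/-- A point whose stabilizer contains all linear parts. -/
def IsSpecialPoint (x : E n) : Prop :=
  ∀ g ∈ P.reflectionGroup, ∃ h ∈ P.reflectionGroup, h x = x ∧ linHom h = linHom g

/-- Mirrors in the simple directions have a common point by linear independence, and the linear
parts of their reflections generate those of all reflections. -/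
theorem exists_isSpecialPoint : ∃ x, P.IsSpecialPoint x := by
  obtain ⟨S, hSR, hind, hgen⟩ := exists_simpleSystem P.finite_mirrorNormals (fun r hr => hr.1)
    fun r hr s hs => P.reflect_mem_mirrorNormals hr hs
  choose! c hc using fun s (hs : s ∈ (S : Set (E n))) => (hSR hs).2
  obtain ⟨x, hx⟩ := exists_inner_eq hind (fun s => c s)
  refine ⟨x, ?_⟩
  have hK := hgen ((P.stabilizer x).map linHom) (fun s hs => by
    have hs1 : ‖s‖ = 1 := (hSR hs).1
    refine ⟨hyperplaneReflection s (c s), ⟨hc s hs, (reflection_fixed hs1).2 (hx ⟨s, hs⟩)⟩, ?_⟩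
    exact linHom_reflection_congr hs1 _ _)
  have hle : P.reflectionGroup.map linHom ≤ (P.stabilizer x).map linHom := by
    rw [Subgroup.map_le_iff_le_comap, reflectionGroup, Subgroup.closure_le]
    rintro _ ⟨j, rfl⟩
    have h1 := hK _ (P.normal_mem_mirrorNormals j)
    rw [linHom_reflection_congr (P.norm_normal j) 0 (P.offset j)] at h1
    exact h1
  intro g hg
  obtain ⟨h, hh, hlin⟩ := hle ⟨g, hg, rfl⟩
  exact ⟨h, hh.1, hh.2, hlin⟩

theorem IsSpecialPoint.map {x : E n} (hx : P.IsSpecialPoint x) {g : E n ≃ᵃⁱ[ℝ] E n}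
    (hg : g ∈ P.reflectionGroup) : P.IsSpecialPoint (g x) := by
  intro k hk
  obtain ⟨h, hh, hhx, hlin⟩ := hx (g⁻¹ * k * g)
    (P.reflectionGroup.mul_mem (P.reflectionGroup.mul_mem (P.reflectionGroup.inv_mem hg) hk) hg)
  refine ⟨g * h * g⁻¹,
    P.reflectionGroup.mul_mem (P.reflectionGroup.mul_mem hg hh) (P.reflectionGroup.inv_mem hg),
    ?_, ?_⟩
  · rw [mul_apply', mul_apply', inv_apply_self', hhx]
  · rw [map_mul, map_mul, hlin, ← map_mul, ← map_mul]
    congr 1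
    group

theorem IsSpecialPoint.reflection_mem {x : E n} (hx : P.IsSpecialPoint x) {u : E n}
    (hu : u ∈ P.mirrorNormals) : hyperplaneReflection u ⟪u, x⟫ ∈ P.reflectionGroup := by
  obtain ⟨hu1, b, hb⟩ := hu
  obtain ⟨h, hh, hhx, hlin⟩ := hx _ hb
  rwa [← eq_reflection_of_fixed hu1 hlin hhx]

/-- Parallel to each facet there is a mirror through `x`, which does not cut the polytope. A segment
in the polytope around `x` is therefore parallel to all facets. -/
theorem IsSpecialPoint.mem_extremePoints {x : E n} (hx : P.IsSpecialPoint x)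
    (hxP : x ∈ P.carrier) : x ∈ Set.extremePoints ℝ P.carrier := by
  refine ⟨hxP, fun y hy z hz hxyz => ?_⟩
  obtain ⟨a, b, ha, hb, hab, rfl⟩ := hxyz
  have hyz : y - z = 0 := by
    refine P.eq_zero_of_inner_eq_zero fun j => ?_
    have h1 := P.carrier_le_or_ge (P.norm_normal j)
      (hx.reflection_mem P (P.normal_mem_mirrorNormals j))
    rw [inner_add_right, inner_smul_right, inner_smul_right] at h1
    rw [inner_sub_right]
    have hb' : b = 1 - a := by linarith
    subst hb'
    rcases h1 with h | h
    · have h2 := h y hy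
      have h3 := h z hz
      nlinarith
    · have h2 := h y hy
      have h3 := h z hz
      nlinarith
  rw [sub_eq_zero.1 hyz, ← add_smul, hab, one_smul]

theorem isSpecialVertex_iff {V : E n} :
    P.IsSpecialVertex V ↔ V ∈ Set.extremePoints ℝ P.carrier ∧ P.IsSpecialPoint V := by
  refine and_congr_right fun _ => forall₂_congr fun g _ => ?_
  constructor
  · rintro ⟨h, hh, hlin⟩; exact ⟨h, hh.1, hh.2, hlin⟩
  · rintro ⟨h, hh, hhV, hlin⟩; exact ⟨h, ⟨hh, hhV⟩, hlin⟩

theorem exists_isSpecialVertex : ∃ V, P.IsSpecialVertex V := by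
  obtain ⟨x, hx⟩ := P.exists_isSpecialPoint
  obtain ⟨g, hg, hgx⟩ := P.exists_map_mem_carrier x
  have h := hx.map P hg
  exact ⟨g x, P.isSpecialVertex_iff.2 ⟨h.mem_extremePoints P hgx, h⟩⟩

/-! ### The facets at a vertex -/

/-- The facets through the point `V`. -/
abbrev FacetsAt (V : E n) : Type := {j : Fin P.numFacets // P.slack j V = 0}

/-- Small steps from `V` along `d` and `-d` would both stay in the polytope, against extremality. -/
theorem eq_zero_of_inner_facetsAt {V : E n} (hV : V ∈ Set.extremePoints ℝ P.carrier) {d : E n}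
    (hd : ∀ i : P.FacetsAt V, ⟪P.normal i, d⟫ = 0) : d = 0 := by
  have hev : ∀ v : E n, (∀ i : P.FacetsAt V, ⟪P.normal i, v⟫ = 0) →
      ∀ᶠ t : ℝ in nhdsWithin 0 (Set.Ioi 0), V + t • v ∈ P.carrier := by
    intro v hv
    simp only [mem_carrier_iff]
    refine Filter.eventually_all.2 fun j => ?_
    by_cases hj : P.slack j V = 0
    · refine Filter.Eventually.of_forall fun t => ?_
      rw [slack, inner_add_right, inner_smul_right, hv ⟨j, hj⟩, mul_zero, add_zero]
      exact hj.ge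
    · have hpos : 0 < P.slack j V := lt_of_le_of_ne ((P.mem_carrier_iff V).1 hV.1 j) (Ne.symm hj)
      have hc : Continuous fun t : ℝ => P.slack j (V + t • v) := by
        simp only [slack]; fun_prop
      have : ∀ᶠ t : ℝ in nhds 0, 0 < P.slack j (V + t • v) := by
        refine hc.continuousAt.eventually (lt_mem_nhds ?_)
        simpa using hpos
      exact (this.filter_mono nhdsWithin_le_nhds).mono fun t ht => ht.le
  obtain ⟨t, ⟨h1, h2⟩, ht⟩ := (((hev d hd).and (hev (-d) (fun i => by
    rw [inner_neg_right, hd i, neg_zero]))).and self_mem_nhdsWithin).exists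
  have h3 := hV.2 h1 h2 ⟨1 / 2, 1 / 2, by norm_num, by norm_num, by norm_num, by module⟩
  rw [add_eq_left] at h3
  exact (smul_eq_zero.1 h3).resolve_left (ne_of_gt ht)

theorem linearIndependent_facetsAt (V : E n) :
    LinearIndependent ℝ fun i : P.FacetsAt V => P.normal i := by
  obtain ⟨p, hp⟩ := P.exists_interior_point
  refine linearIndependent_of_inner_nonpos (q := V - p) ?_ ?_
  · intro i j hij
    exact P.inner_normal_nonpos fun h => hij (Subtype.ext h)
  · intro i
    have h1 : P.offset i - ⟪P.normal i, V⟫ = 0 := i.2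
    rw [inner_sub_right]
    linarith [hp i]

theorem span_facetsAt {V : E n} (hV : V ∈ Set.extremePoints ℝ P.carrier) :
    Submodule.span ℝ (Set.range fun i : P.FacetsAt V => P.normal i) = ⊤ := by
  rw [← Submodule.orthogonal_eq_bot_iff, Submodule.eq_bot_iff]
  intro d hd
  exact P.eq_zero_of_inner_facetsAt hV fun i =>
    (Submodule.mem_orthogonal _ _).1 hd _ (Submodule.subset_span ⟨i, rfl⟩)

/-- The normals of the facets at a vertex form a basis. -/
noncomputable def vertexBasis {V : E n} (hV : V ∈ Set.extremePoints ℝ P.carrier) :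
    Module.Basis (P.FacetsAt V) ℝ (E n) :=
  Module.Basis.mk (P.linearIndependent_facetsAt V) (P.span_facetsAt hV).ge

theorem vertexBasis_apply {V : E n} (hV : V ∈ Set.extremePoints ℝ P.carrier) (i : P.FacetsAt V) :
    P.vertexBasis hV i = P.normal i := Module.Basis.mk_apply _ _ i

/-- Each normal of a facet not through the vertex `V` is a nonpositive combination of the normals
at `V`; the supports of these combinations are a partition of the facets through `V`. -/
theorem exists_vertex_coeff {V : E n} (hV : V ∈ Set.extremePoints ℝ P.carrier) :
    ∃ c : Fin P.numFacets → P.FacetsAt V → ℝ,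
      (∀ j, P.slack j V ≠ 0 → P.normal j = -∑ i, c j i • P.normal i) ∧
      (∀ j i, P.slack j V ≠ 0 → 0 ≤ c j i) ∧
      (∀ j j' i, P.slack j V ≠ 0 → P.slack j' V ≠ 0 → j ≠ j' → c j i * c j' i = 0) ∧
      (∀ i, ∃ j, P.slack j V ≠ 0 ∧ c j i ≠ 0) := by
  set B := P.vertexBasis hV with hB
  have hind := Fintype.linearIndependent_iff.1 (P.linearIndependent_facetsAt V)
  have hobt : ∀ i j : P.FacetsAt V, i ≠ j → ⟪P.normal i, P.normal j⟫ ≤ 0 := fun i j hij =>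
    P.inner_normal_nonpos fun h => hij (Subtype.ext h)
  have hobt' : ∀ (i : P.FacetsAt V) (j), P.slack j V ≠ 0 → ⟪P.normal j, P.normal i⟫ ≤ 0 :=
    fun i j hj => P.inner_normal_nonpos fun h => hj (h ▸ i.2)
  set c : Fin P.numFacets → P.FacetsAt V → ℝ := fun j i => -B.repr (P.normal j) i with hc
  have hsum : ∀ j, P.normal j = -∑ i, c j i • P.normal i := by
    intro j
    simp only [hc, neg_smul, Finset.sum_neg_distrib, neg_neg]
    have := B.sum_repr (P.normal j)
    simp only [hB, vertexBasis_apply] at this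
    exact this.symm
  -- Writing the outer normal as `q - p`, both `⟪P.normal j, q⟫` and `⟪p, q⟫` are nonpositive, and
  -- their sum is `⟪q, q⟫`.
  have hnonneg : ∀ j i, P.slack j V ≠ 0 → 0 ≤ c j i := by
    intro j i hj
    set q := ∑ i, (c j i)⁻ • P.normal i with hq
    set p := ∑ i, (c j i)⁺ • P.normal i with hp
    have h1 : ⟪p, q⟫ ≤ 0 := inner_sum_posPart_sum_negPart_nonpos hobt (c j)
    have h2 : P.normal j = q - p := by
      rw [hsum j, hq, hp, ← Finset.sum_sub_distrib, ← Finset.sum_neg_distrib]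
      refine Finset.sum_congr rfl fun i _ => ?_
      rw [← sub_smul, ← neg_smul, ← neg_sub (c j i)⁺, posPart_sub_negPart]
    have h3 : ⟪P.normal j, q⟫ ≤ 0 := by
      rw [hq, inner_sum]
      refine Finset.sum_nonpos fun i _ => ?_
      rw [inner_smul_right]
      exact mul_nonpos_of_nonneg_of_nonpos (negPart_nonneg _) (hobt' i j hj)
    have h4 : q = 0 := by
      rw [h2, inner_sub_left] at h3
      exact inner_self_eq_zero.1 (le_antisymm (by linarith) real_inner_self_nonneg)
    have h5 := hind _ h4 i
    exact negPart_eq_zero.1 h5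
  refine ⟨c, fun j _ => hsum j, hnonneg, ?_, ?_⟩
  · intro j j' i hj hj' hjj'
    -- the facets outside of the block of `j` are orthogonal to that block
    have h1 : ∀ w : E n, (∀ i, c j i * ⟪P.normal i, w⟫ ≤ 0) → ⟪P.normal j, w⟫ ≤ 0 →
        ∀ i, c j i * ⟪P.normal i, w⟫ = 0 := by
      intro w hw hjw
      rw [hsum j, inner_neg_left, sum_inner] at hjw
      simp only [inner_smul_left, conj_trivial] at hjw
      intro i
      have h2 : ∑ i, c j i * ⟪P.normal i, w⟫ = 0 :=
        le_antisymm (Finset.sum_nonpos fun i _ => hw i) (by linarith)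
      exact (Finset.sum_eq_zero_iff_of_nonpos fun i _ => hw i).1 h2 i (Finset.mem_univ _)
    have h2 := h1 (P.normal j')
      (fun i => mul_nonpos_of_nonneg_of_nonpos (hnonneg j i hj)
        (by rw [real_inner_comm]; exact hobt' i j' hj'))
      (P.inner_normal_nonpos hjj')
    have h3 : ∀ k, c j k = 0 → ∀ i, c j i * ⟪P.normal i, P.normal k⟫ = 0 := by
      intro k hk
      refine h1 (P.normal k) (fun i => ?_) (hobt' k j hj)
      rcases eq_or_ne i k with rfl | hik
      · rw [hk, zero_mul]
      · exact mul_nonpos_of_nonneg_of_nonpos (hnonneg j i hj) (hobt i k hik)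
    -- The part of `c j'` supported on the block of `j`. Its vector is orthogonal to `P.normal j'`
    -- and to the remaining part, hence to itself.
    set a : P.FacetsAt V → ℝ := fun i => if c j i = 0 then 0 else c j' i with ha
    have h4 : ⟪∑ i, a i • P.normal i, P.normal j'⟫ = 0 := by
      rw [sum_inner]
      refine Finset.sum_eq_zero fun i _ => ?_
      rw [inner_smul_left]
      by_cases hi : c j i = 0
      · simp [ha, hi]
      · rw [(mul_eq_zero.1 (h2 i)).resolve_left hi, mul_zero]
    have h5 : ⟪∑ i, a i • P.normal i, ∑ i, (c j' i - a i) • P.normal i⟫ = 0 := by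
      rw [sum_inner]
      refine Finset.sum_eq_zero fun i _ => ?_
      rw [inner_sum]
      refine Finset.sum_eq_zero fun k _ => ?_
      rw [inner_smul_left, inner_smul_right]
      by_cases hi : c j i = 0
      · simp [ha, hi]
      by_cases hk : c j k = 0
      · rw [(mul_eq_zero.1 (h3 k hk i)).resolve_left hi]; simp
      · simp [ha, hk]
    have h6 : ∑ i, a i • P.normal i = 0 := by
      have h7 : P.normal j' = -(∑ i, a i • P.normal i + ∑ i, (c j' i - a i) • P.normal i) := by
        rw [← Finset.sum_add_distrib]
        simp only [← add_smul, add_sub_cancel]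
        exact hsum j'
      rw [h7, inner_neg_right, inner_add_right, h5, add_zero, neg_eq_zero] at h4
      exact inner_self_eq_zero.1 h4
    have h8 := hind a h6 i
    by_cases hi : c j i = 0
    · rw [hi, zero_mul]
    · simp only [ha, if_neg hi] at h8
      rw [h8, mul_zero]
  · intro i
    -- If no outer facet involved facet `i`, the direction dual to its normal would span a ray in
    -- the polytope.
    by_contra! hcon
    obtain ⟨d, hd⟩ := exists_inner_eq (P.linearIndependent_facetsAt V)
      (fun k => if k = i then (-1 : ℝ) else 0)
    have h0 : d = 0 := by
      refine P.eq_zero_of_inner_nonpos fun j => ?_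
      by_cases hj : P.slack j V = 0
      · have := hd ⟨j, hj⟩
        rw [this]; split_ifs <;> norm_num
      · rw [hsum j, inner_neg_left, sum_inner]
        simp only [inner_smul_left, hd]
        simp [hcon j hj]
    have := hd i
    rw [h0] at this
    simp at this

/-! ### Moving and rescaling a Coxeter polytope -/

/-- Points of the vertex cone with prescribed values on the facets not through the vertex. -/
theorem exists_inner_facets {V : E n} (hV : V ∈ Set.extremePoints ℝ P.carrier)
    (τ : Fin P.numFacets → ℝ) (hτ : ∀ j, P.slack j V ≠ 0 → 0 < τ j) :
    ∃ y : E n, (∀ j, P.slack j V = 0 → ⟪P.normal j, y⟫ < 0) ∧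
      (∀ j, P.slack j V ≠ 0 → ⟪P.normal j, y⟫ = τ j) ∧
      ∀ i, P.slack i V = 0 → ∃ z : E n, ⟪P.normal i, z⟫ = 0 ∧
        (∀ j, P.slack j V = 0 → j ≠ i → ⟪P.normal j, z⟫ < 0) ∧
        ∀ j, P.slack j V ≠ 0 → ⟪P.normal j, z⟫ ≤ τ j := by
  classical
  obtain ⟨c, hsum, hnonneg, hdisj, hcov⟩ := P.exists_vertex_coeff hV
  have hval : ∀ (y : E n) (j), P.slack j V ≠ 0 →
      ⟪P.normal j, y⟫ = -∑ i, c j i * ⟪P.normal i, y⟫ := by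
    intro y j hj
    rw [hsum j hj, inner_neg_left, sum_inner]
    simp only [inner_smul_left, conj_trivial]
  set J := Finset.univ.filter fun j : Fin P.numFacets => P.slack j V ≠ 0 with hJ
  have hJm : ∀ j, j ∈ J ↔ P.slack j V ≠ 0 := fun j => by simp [hJ]
  set N : Fin P.numFacets → ℝ := fun j => ∑ i, c j i ^ 2 with hN
  have hNpos : ∀ j i, P.slack j V ≠ 0 → c j i ≠ 0 → 0 < N j := by
    intro j i hj hji
    exact Finset.sum_pos' (fun _ _ => sq_nonneg _) ⟨i, Finset.mem_univ _, by positivity⟩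
  have hN0 : ∀ j, P.slack j V ≠ 0 → N j ≠ 0 := by
    intro j hj h0
    have : P.normal j = 0 := by
      rw [hsum j hj, Finset.sum_eq_zero, neg_zero]
      intro i _
      by_cases h : c j i = 0
      · rw [h, zero_smul]
      · exact absurd h0 (hNpos j i hj h).ne'
    have h1 := P.norm_normal j
    rw [this, norm_zero] at h1
    exact zero_ne_one h1
  have hNnn : ∀ j, 0 ≤ N j := fun j => Finset.sum_nonneg fun i _ => sq_nonneg _
  -- The blocks are disjoint, so only one term is nonzero. Division by the sum of squares `N j` of
  -- the block makes the weighted sum over it equal to `τ j`.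
  set η : P.FacetsAt V → ℝ := fun i => ∑ j ∈ J, τ j * c j i / N j with hη
  have hηpos : ∀ i, 0 < η i := by
    intro i
    obtain ⟨j, hj, hji⟩ := hcov i
    refine Finset.sum_pos' (fun k hk => ?_) ⟨j, (hJm j).2 hj, ?_⟩
    · have hk' := (hJm k).1 hk
      exact div_nonneg (mul_nonneg (hτ k hk').le (hnonneg k i hk')) (hNnn k)
    · exact div_pos (mul_pos (hτ j hj) (lt_of_le_of_ne (hnonneg j i hj) (Ne.symm hji)))
        (hNpos j i hj hji)
  have hηsum : ∀ j, P.slack j V ≠ 0 → ∑ i, c j i * η i = τ j := by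
    intro j hj
    have h1 : ∀ i, c j i * η i = τ j * (c j i ^ 2 / N j) := by
      intro i
      rw [hη, Finset.mul_sum, Finset.sum_eq_single_of_mem j ((hJm j).2 hj)]
      · ring
      · intro k hk hkj
        have := hdisj j k i hj ((hJm k).1 hk) (Ne.symm hkj)
        rw [mul_div_assoc', mul_left_comm, this]; simp
    simp only [h1]
    rw [← Finset.mul_sum, ← Finset.sum_div, div_self (hN0 j hj), mul_one]
  obtain ⟨y, hy⟩ := exists_inner_eq (P.linearIndependent_facetsAt V) (fun i => -η i)
  refine ⟨y, fun j hj => ?_, fun j hj => ?_, fun i hi => ?_⟩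
  · rw [hy ⟨j, hj⟩]; linarith [hηpos ⟨j, hj⟩]
  · rw [hval y j hj, ← hηsum j hj]
    simp only [hy]
    simp
  -- Replacing one `η i` by 0 puts the point on facet `i` and can only decrease the outer values.
  · obtain ⟨z, hz⟩ := exists_inner_eq (P.linearIndependent_facetsAt V)
      (fun k => if k = ⟨i, hi⟩ then 0 else -η k)
    refine ⟨z, by rw [hz ⟨i, hi⟩, if_pos rfl], fun j hj hji => ?_, fun j hj => ?_⟩
    · rw [hz ⟨j, hj⟩, if_neg (fun h => hji (congrArg Subtype.val h))]
      linarith [hηpos ⟨j, hj⟩]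
    · rw [hval z j hj, ← hηsum j hj, ← Finset.sum_neg_distrib]
      refine Finset.sum_le_sum fun k _ => ?_
      rw [hz k]
      split_ifs
      · rw [mul_zero, neg_zero]; exact mul_nonneg (hnonneg j k hj) (hηpos k).le
      · linarith

/-- The polytope with the normals `O (P.normal j)`, a vertex at `W` that corresponds to the vertex
`V` of `P`, and prescribed distances of the remaining facets to `W`. -/
noncomputable def movedPolytope {V : E n} (hV : V ∈ Set.extremePoints ℝ P.carrier)
    (O : E n ≃ₗᵢ[ℝ] E n) (W : E n) (δ : Fin P.numFacets → ℝ)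
    (hδ0 : ∀ j, P.slack j V = 0 → δ j = 0) (hδ : ∀ j, P.slack j V ≠ 0 → 0 < δ j) :
    Polytope n where
  numFacets := P.numFacets
  normal j := O (P.normal j)
  offset j := ⟪O (P.normal j), W⟫ + δ j
  norm_normal j := norm_linHom O (P.norm_normal j)
  exists_interior_point := by
    obtain ⟨y, hy, hy', -⟩ := P.exists_inner_facets hV (fun j => δ j / 2)
      (fun j hj => half_pos (hδ j hj))
    refine ⟨W + O y, fun j => ?_⟩
    rw [inner_add_right, LinearIsometryEquiv.inner_map_map]
    by_cases hj : P.slack j V = 0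
    · linarith [hy j hj, hδ0 j hj]
    · linarith [hy' j hj, hδ j hj]
  exists_facet_point i := by
    by_cases hi : P.slack i V = 0
    · obtain ⟨-, -, -, h⟩ := P.exists_inner_facets hV (fun j => δ j / 2)
        (fun j hj => half_pos (hδ j hj))
      obtain ⟨z, hz, hz', hz''⟩ := h i hi
      refine ⟨W + O z, ?_, fun j hji => ?_⟩
      · rw [inner_add_right, LinearIsometryEquiv.inner_map_map, hz, hδ0 i hi]
      · rw [inner_add_right, LinearIsometryEquiv.inner_map_map]
        by_cases hj : P.slack j V = 0
        · linarith [hz' j hj hji, hδ0 j hj]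
        · linarith [hz'' j hj, hδ j hj]
    -- The full distance on facet `i` reaches that facet; half of it on the others stays strictly
    -- inside them.
    · obtain ⟨y, hy, hy', -⟩ := P.exists_inner_facets hV
        (fun j => if j = i then δ j else δ j / 2)
        (fun j hj => by
          have := hδ j hj
          split_ifs <;> linarith)
      refine ⟨W + O y, ?_, fun j hji => ?_⟩
      · rw [inner_add_right, LinearIsometryEquiv.inner_map_map, hy' i hi, if_pos rfl]
      · rw [inner_add_right, LinearIsometryEquiv.inner_map_map]
        by_cases hj : P.slack j V = 0
        · linarith [hy j hj, hδ0 j hj]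
        · have h1 := hy' j hj
          rw [if_neg hji] at h1
          linarith [hδ j hj]
  volume_lt_top := by
    refine Bornology.IsBounded.measure_lt_top (Polytope.exists_bound_of_noRay _ _ fun d hd => ?_)
    have h1 : O.symm d = 0 := P.eq_zero_of_inner_nonpos fun j => by
      have := hd j
      rwa [← O.apply_symm_apply d, LinearIsometryEquiv.inner_map_map] at this
    simpa using h1

theorem movedPolytope_facetsMeet {V : E n} (hV : V ∈ Set.extremePoints ℝ P.carrier)
    (O : E n ≃ₗᵢ[ℝ] E n) (W : E n) (δ : Fin P.numFacets → ℝ)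
    (hδ0 : ∀ j, P.slack j V = 0 → δ j = 0) (hδ : ∀ j, P.slack j V ≠ 0 → 0 < δ j)
    {i j : Fin P.numFacets} (hij : i ≠ j) :
    (P.movedPolytope hV O W δ hδ0 hδ).FacetsMeet i j ↔ P.FacetsMeet i j := by
  refine ((P.movedPolytope hV O W δ hδ0 hδ).facetsMeet_iff (i := i) (j := j) hij).trans
    (Iff.trans ?_ (P.facetsMeet_iff hij).symm)
  refine not_congr (Iff.trans ?_ O.injective.eq_iff)
  rw [map_neg]
  rfl

theorem movedPolytope_dihedralAngle {V : E n} (hV : V ∈ Set.extremePoints ℝ P.carrier)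
    (O : E n ≃ₗᵢ[ℝ] E n) (W : E n) (δ : Fin P.numFacets → ℝ)
    (hδ0 : ∀ j, P.slack j V = 0 → δ j = 0) (hδ : ∀ j, P.slack j V ≠ 0 → 0 < δ j)
    (i j : Fin P.numFacets) :
    (P.movedPolytope hV O W δ hδ0 hδ).dihedralAngle i j = P.dihedralAngle i j := by
  exact congrArg (fun x => Real.pi - x) (LinearIsometry.angle_map O.toLinearIsometry _ _)

theorem diagramLabel_congr (Q P : CoxeterPolytope n) {i j : Fin Q.numFacets}
    {k l : Fin P.numFacets} (he : i = j ↔ k = l) (hm : k ≠ l → (Q.FacetsMeet i j ↔ P.FacetsMeet k l))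
    (ha : Q.dihedralAngle i j = P.dihedralAngle k l) : Q.diagramLabel i j = P.diagramLabel k l := by
  unfold diagramLabel
  by_cases hij : k = l
  · rw [if_pos hij, if_pos (he.2 hij)]
  · rw [if_neg hij, if_neg (mt he.1 hij), ha]
    by_cases h : P.FacetsMeet k l
    · rw [if_pos h, if_pos ((hm hij).2 h)]
    · rw [if_neg h, if_neg (mt (hm hij).1 h)]

/-- `movedPolytope` as a Coxeter polytope. -/
noncomputable def moved {V : E n} (hV : V ∈ Set.extremePoints ℝ P.carrier)
    (O : E n ≃ₗᵢ[ℝ] E n) (W : E n) (δ : Fin P.numFacets → ℝ)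
    (hδ0 : ∀ j, P.slack j V = 0 → δ j = 0) (hδ : ∀ j, P.slack j V ≠ 0 → 0 < δ j) :
    CoxeterPolytope n where
  toPolytope := P.movedPolytope hV O W δ hδ0 hδ
  dihedralAngle_eq := by
    intro i j hij hmeet
    obtain ⟨m, hm, h⟩ := P.dihedralAngle_eq i j hij
      ((P.movedPolytope_facetsMeet hV O W δ hδ0 hδ hij).1 hmeet)
    exact ⟨m, hm, (P.movedPolytope_dihedralAngle hV O W δ hδ0 hδ i j).trans h⟩

theorem moved_sameDiagram {V : E n} (hV : V ∈ Set.extremePoints ℝ P.carrier)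
    (O : E n ≃ₗᵢ[ℝ] E n) (W : E n) (δ : Fin P.numFacets → ℝ)
    (hδ0 : ∀ j, P.slack j V = 0 → δ j = 0) (hδ : ∀ j, P.slack j V ≠ 0 → 0 < δ j) :
    (P.moved hV O W δ hδ0 hδ).SameDiagram P := by
  refine ⟨Equiv.refl _, ?_⟩
  ext i j
  change (P.moved hV O W δ hδ0 hδ).diagramLabel i j = P.diagramLabel i j
  refine diagramLabel_congr _ _ Iff.rfl (fun hij => ?_) ?_
  · exact P.movedPolytope_facetsMeet hV O W δ hδ0 hδ hij
  · exact P.movedPolytope_dihedralAngle hV O W δ hδ0 hδ i j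

end CoxeterPolytope

/-! ### Translations and integrality -/

namespace CoxeterPolytope

variable (P : CoxeterPolytope n)

/-- Every point is within a bounded distance of the orbit of `V`, so some `g⁻¹ V` lies farther out
in the direction `u`. As `V` is special, a translation in the group takes `V` there, and with it the
mirror through `V`. -/
theorem exists_parallel_mirror {V : E n} (hV : P.IsSpecialPoint V) {u : E n}
    (hu : u ∈ P.mirrorNormals) :
    ∃ d : ℝ, 0 < d ∧ hyperplaneReflection u (⟪u, V⟫ + d) ∈ P.reflectionGroup := by
  obtain ⟨C, hC⟩ := (Metric.isBounded_iff_subset_closedBall V).1 P.isBounded_carrier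
  obtain ⟨g, hg, hgx⟩ := P.exists_map_mem_carrier (V + (|C| + 1) • u)
  have h1 := Metric.mem_closedBall.1 (hC hgx)
  have h2 : dist (V + (|C| + 1) • u) (g⁻¹ V) ≤ C := by
    rw [← g.dist_map]
    rwa [apply_inv_self']
  have h3 : ⟪u, V + (|C| + 1) • u - g⁻¹ V⟫ ≤ C := by
    refine (real_inner_le_norm _ _).trans ?_
    rwa [hu.1, one_mul, ← dist_eq_norm]
  rw [inner_sub_right, inner_add_right, inner_smul_right, inner_self_of_unit hu.1] at h3
  have hg' := P.reflectionGroup.inv_mem hg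
  refine ⟨⟪u, g⁻¹ V⟫ - ⟪u, V⟫, by linarith [le_abs_self C], ?_⟩
  obtain ⟨h, hh, hhV, hlin⟩ := hV _ hg'
  have h4 := reflection_conj' (g⁻¹ * h⁻¹) hu.1 (b := ⟪u, V⟫) (x := V) rfl
  have h5 : linHom (g⁻¹ * h⁻¹) = 1 := by rw [map_mul, map_inv linHom h, hlin, mul_inv_cancel]
  have h6 : h⁻¹ V = V := by nth_rw 1 [← hhV]; exact inv_apply_self' _ _
  rw [h5, mul_apply', h6] at h4
  rw [add_sub_cancel]
  change _ = hyperplaneReflection u ⟪u, g⁻¹ V⟫ at h4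
  rw [← h4]
  have h7 := P.reflectionGroup.mul_mem hg' (P.reflectionGroup.inv_mem hh)
  exact P.reflectionGroup.mul_mem (P.reflectionGroup.mul_mem h7 (hV.reflection_mem P hu))
    (P.reflectionGroup.inv_mem h7)

/-- The translations in the direction `u` in the reflection group. -/
def translationLengths (u : E n) : AddSubgroup ℝ where
  carrier := {d | ∃ g ∈ P.reflectionGroup, ∀ x, g x = x + d • u}
  zero_mem' := ⟨1, P.reflectionGroup.one_mem, fun x => by simp⟩
  add_mem' := by
    rintro a b ⟨g, hg, hgx⟩ ⟨h, hh, hhx⟩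
    refine ⟨g * h, P.reflectionGroup.mul_mem hg hh, fun x => ?_⟩
    rw [mul_apply', hgx, hhx]
    module
  neg_mem' := by
    rintro a ⟨g, hg, hgx⟩
    refine ⟨g⁻¹, P.reflectionGroup.inv_mem hg, fun x => ?_⟩
    have : g (x + -a • u) = x := by rw [hgx]; module
    nth_rw 1 [← this]
    exact inv_apply_self' _ _

/-- The commutator of a translation with a reflection is a translation along the normal of the
mirror. -/
theorem translationLengths_smul_inner {u v : E n} (hv : v ∈ P.mirrorNormals) {d : ℝ}
    (hd : d ∈ P.translationLengths u) : 2 * ⟪v, u⟫ * d ∈ P.translationLengths v := by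
  obtain ⟨g, hg, hgx⟩ := hd
  obtain ⟨hv1, b, hb⟩ := hv
  set r := hyperplaneReflection v b with hr
  have hdiff : ∀ x, (g * r * g⁻¹ * r) x = x + (2 * ⟪v, u⟫ * d) • v := by
    intro x
    have hginv : ∀ y, g⁻¹ y = y - d • u := by
      intro y
      have : g (y - d • u) = y := by rw [hgx]; module
      nth_rw 1 [← this]
      exact inv_apply_self' _ _
    rw [mul_apply', mul_apply', mul_apply', hgx, hginv, sub_eq_add_neg (r x), map_add_eq,
      ← mul_apply', hr, reflection_mul_self hv1, map_neg, map_smul, linHom_reflection_apply hv1]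
    change x + _ + _ = _
    module
  refine ⟨g * r * g⁻¹ * r, ?_, hdiff⟩
  exact P.reflectionGroup.mul_mem (P.reflectionGroup.mul_mem (P.reflectionGroup.mul_mem hg hb)
    (P.reflectionGroup.inv_mem hg)) hb

/-- Two parallel mirrors give a nonzero translation, and proper discontinuity gives a least positive
length, so the subgroup of lengths is cyclic. -/
theorem exists_translationLengths_eq {u : E n} (hu : u ∈ P.mirrorNormals) :
    ∃ a : ℝ, 0 < a ∧ ∀ d, d ∈ P.translationLengths u ↔ ∃ k : ℤ, d = k * a := by
  obtain ⟨V, hV⟩ := P.exists_isSpecialPoint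
  have hu1 := hu.1
  have hu0 : u ≠ 0 := by rintro rfl; simp at hu1
  -- a positive translation length
  obtain ⟨d, hd, hrd⟩ := P.exists_parallel_mirror hV hu
  have hmem : 2 * d ∈ P.translationLengths u := by
    refine ⟨_, P.reflectionGroup.mul_mem hrd (hV.reflection_mem P hu), fun x => ?_⟩
    rw [mul_apply', reflection_apply hu1, reflection_apply hu1, inner_sub_right, inner_smul_right,
      inner_self_of_unit hu1]
    module
  -- finitely many lengths in a bounded interval
  have hfin : {t | t ∈ P.translationLengths u ∧ 0 < t ∧ t ≤ 2 * d}.Finite := by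
    have hG := P.finite_setOf_dist_le V V (2 * d)
    refine (hG.image fun g => ⟪u, g V - V⟫).subset ?_
    rintro t ⟨⟨g, hg, hgx⟩, ht0, ht⟩
    refine ⟨g, ⟨hg, ?_⟩, ?_⟩
    · rw [hgx, dist_eq_norm, add_sub_cancel_left, norm_smul, hu1, mul_one,
        Real.norm_of_nonneg ht0.le]
      exact ht
    · dsimp only
      rw [hgx, add_sub_cancel_left, inner_smul_right, inner_self_of_unit hu1, mul_one]
  obtain ⟨a, ⟨haL, ha0, had⟩, hmin⟩ := Set.exists_min_image _ id hfin
    ⟨2 * d, hmem, by linarith, le_rfl⟩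
  have hleast : IsLeast {g : ℝ | g ∈ P.translationLengths u ∧ 0 < g} a := by
    refine ⟨⟨haL, ha0⟩, fun t ht => ?_⟩
    rcases le_total t (2 * d) with h | h
    · exact hmin t ⟨ht.1, ht.2, h⟩
    · exact had.trans h
  have hcyc := AddSubgroup.cyclic_of_min hleast
  refine ⟨a, ha0, fun t => ?_⟩
  rw [hcyc, AddSubgroup.mem_closure_singleton]
  simp only [zsmul_eq_mul, eq_comm]

/-- The crystallographic restriction. -/
theorem exists_int_eq_four_mul_inner_sq {u v : E n} (hu : u ∈ P.mirrorNormals)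
    (hv : v ∈ P.mirrorNormals) : ∃ k : ℤ, 4 * ⟪u, v⟫ ^ 2 = k := by
  obtain ⟨a, ha, haL⟩ := P.exists_translationLengths_eq hu
  obtain ⟨b, hb, hbL⟩ := P.exists_translationLengths_eq hv
  -- With `c = ⟪u, v⟫`, commutators give `2 * c * a = k * b` and `2 * c * b = l * a`; multiplying
  -- them leaves `4 * c ^ 2 = k * l`.
  obtain ⟨k, hk⟩ := (hbL _).1 (P.translationLengths_smul_inner hv ((haL a).2 ⟨1, by simp⟩))
  obtain ⟨l, hl⟩ := (haL _).1 (P.translationLengths_smul_inner hu ((hbL b).2 ⟨1, by simp⟩))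
  refine ⟨k * l, ?_⟩
  rw [real_inner_comm] at hk
  have h1 : (4 * ⟪u, v⟫ ^ 2) * (a * b) = ((k * l : ℤ) : ℝ) * (a * b) := by
    push_cast
    calc (4 * ⟪u, v⟫ ^ 2) * (a * b) = (2 * ⟪u, v⟫ * a) * (2 * ⟪u, v⟫ * b) := by ring
      _ = (k * b) * (l * a) := by rw [hk, hl]
      _ = _ := by ring
  exact mul_right_cancel₀ (mul_pos ha hb).ne' h1

end CoxeterPolytope

/-! ### Orders of products of two reflections -/

theorem linHom_reflection_mul_apply {u v : E n} (hu : ‖u‖ = 1) (hv : ‖v‖ = 1) (a b : ℝ) (w : E n) :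
    linHom (hyperplaneReflection u a * hyperplaneReflection v b) w
      = w + (4 * ⟪u, v⟫ * ⟪v, w⟫ - 2 * ⟪u, w⟫) • u - (2 * ⟪v, w⟫) • v := by
  rw [map_mul, lin_mul_apply, linHom_reflection_apply hv, linHom_reflection_apply hu,
    inner_sub_right, inner_smul_right]
  module

theorem linHom_pow_succ_apply (g : E n ≃ᵃⁱ[ℝ] E n) (k : ℕ) (w : E n) :
    linHom (g ^ (k + 1)) w = linHom (g ^ k) (linHom g w) := by
  rw [pow_succ, map_mul, lin_mul_apply]

/-- The powers applied to `v` stay in the plane of `u` and `v`. Unless these are parallel, the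
coefficient of `v` must be 1 and that of `u` must be 0; the second condition removes the spurious
roots of the first. -/
theorem four_mul_inner_sq_of_pow_eq_one {u v : E n} (hu : ‖u‖ = 1) (hv : ‖v‖ = 1) (a b : ℝ) :
    (hyperplaneReflection u a * hyperplaneReflection v b = 1 → ⟪u, v⟫ ^ 2 = 1) ∧
    ((hyperplaneReflection u a * hyperplaneReflection v b) ^ 2 = 1 →
      4 * ⟪u, v⟫ ^ 2 = 0 ∨ ⟪u, v⟫ ^ 2 = 1) ∧
    ((hyperplaneReflection u a * hyperplaneReflection v b) ^ 3 = 1 →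
      4 * ⟪u, v⟫ ^ 2 = 1 ∨ ⟪u, v⟫ ^ 2 = 1) ∧
    ((hyperplaneReflection u a * hyperplaneReflection v b) ^ 4 = 1 →
      4 * ⟪u, v⟫ ^ 2 = 0 ∨ 4 * ⟪u, v⟫ ^ 2 = 2 ∨ ⟪u, v⟫ ^ 2 = 1) := by
  set ρ := hyperplaneReflection u a * hyperplaneReflection v b with hρ
  set c := ⟪u, v⟫ with hc
  have hcv : ⟪v, u⟫ = c := real_inner_comm _ _
  have huu := inner_self_of_unit hu
  have hvv := inner_self_of_unit hv
  have step : ∀ s t : ℝ, linHom ρ (s • u + t • v)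
      = ((4 * c ^ 2 - 1) * s + 2 * c * t) • u + (-(2 * c) * s - t) • v := by
    intro s t
    rw [hρ, linHom_reflection_mul_apply hu hv]
    simp only [inner_add_right, inner_smul_right, huu, hvv, hcv, ← hc]
    module
  -- a relation between `u` and `v` is trivial unless they are parallel
  have indep : c ^ 2 ≠ 1 → ∀ s t : ℝ, s • u + t • v = v → s = 0 ∧ t = 1 := by
    intro hne s t h
    have h1 := congrArg (fun z => ⟪u, z⟫) h
    have h2 := congrArg (fun z => ⟪v, z⟫) h
    simp only [inner_add_right, inner_smul_right, huu, hvv, hcv, ← hc] at h1 h2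
    have h3 : s * (1 - c ^ 2) = 0 := by linear_combination h1 - c * h2
    have h4 : s = 0 := (mul_eq_zero.1 h3).resolve_right (fun h => hne (by linarith))
    rw [h4] at h2
    exact ⟨h4, by linarith⟩
  have hv0 : v = (0 : ℝ) • u + (1 : ℝ) • v := by module
  have e1 : linHom ρ v = (2 * c) • u + (-1 : ℝ) • v := by
    nth_rw 1 [hv0]; rw [step]; congr 2 <;> ring
  have e2 : linHom (ρ ^ 2) v = (2 * c * (4 * c ^ 2 - 2)) • u + (-(4 * c ^ 2 - 2) - 1) • v := by
    rw [linHom_pow_succ_apply, pow_one, e1, step]; congr 2 <;> ring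
  have e3 : linHom (ρ ^ 3) v = (2 * c * ((4 * c ^ 2 - 2) ^ 2 - 1)) • u
      + (-((4 * c ^ 2 - 2) ^ 2 - 1) - (4 * c ^ 2 - 2)) • v := by
    rw [pow_succ', map_mul, lin_mul_apply, e2, step]; congr 2 <;> ring
  have e4 : linHom (ρ ^ 4) v = (2 * c * ((4 * c ^ 2 - 2) ^ 3 - 2 * (4 * c ^ 2 - 2))) • u
      + (-((4 * c ^ 2 - 2) ^ 3 - 2 * (4 * c ^ 2 - 2)) - ((4 * c ^ 2 - 2) ^ 2 - 1)) • v := by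
    rw [pow_succ', map_mul, lin_mul_apply, e3, step]; congr 2 <;> ring
  have one : linHom (1 : E n ≃ᵃⁱ[ℝ] E n) v = v := rfl
  refine ⟨fun h => ?_, fun h => ?_, fun h => ?_, fun h => ?_⟩
  · by_contra hne
    rw [h, one] at e1
    linarith [(indep hne _ _ e1.symm).2]
  · by_contra! hne
    rw [h, one] at e2
    obtain ⟨-, h2⟩ := indep hne.2 _ _ e2.symm
    exact hne.1 (by linarith)
  · by_contra! hne
    rw [h, one] at e3
    obtain ⟨h1, h2⟩ := indep hne.2 _ _ e3.symm
    have h3 : (4 * c ^ 2 - 2) * (4 * c ^ 2 - 1) = 0 := by linear_combination -h2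
    rcases mul_eq_zero.1 h3 with h4 | h4
    · rw [h4] at h1
      have : c = 0 := by linarith
      rw [this] at h4
      norm_num at h4
    · exact hne.1 (by linarith)
  · by_contra! hne
    rw [h, one] at e4
    obtain ⟨h1, h2⟩ := indep hne.2.2 _ _ e4.symm
    have h3 : (4 * c ^ 2 - 2) * ((4 * c ^ 2) * (4 * c ^ 2 - 3)) = 0 := by linear_combination -h2
    rcases mul_eq_zero.1 h3 with h4 | h4
    · exact hne.2.1 (by linarith)
    rcases mul_eq_zero.1 h4 with h5 | h5
    · exact hne.1 h5
    · have h6 : 4 * c ^ 2 - 2 = 1 := by linarith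
      rw [h6] at h1
      have : c = 0 := by linarith
      rw [this] at h6
      norm_num at h6

/-- The common point `x` of the mirrors reduces the claim to linear parts. Without it, parallel
mirrors would give a nontrivial translation in the case of square 1. -/
theorem pow_eq_one_of_four_mul_inner_sq {u v : E n} (hu : ‖u‖ = 1) (hv : ‖v‖ = 1) {a b : ℝ}
    {x : E n} (hxu : ⟪u, x⟫ = a) (hxv : ⟪v, x⟫ = b) :
    (⟪u, v⟫ ^ 2 = 1 → hyperplaneReflection u a * hyperplaneReflection v b = 1) ∧
    (4 * ⟪u, v⟫ ^ 2 = 0 → (hyperplaneReflection u a * hyperplaneReflection v b) ^ 2 = 1) ∧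
    (4 * ⟪u, v⟫ ^ 2 = 1 → (hyperplaneReflection u a * hyperplaneReflection v b) ^ 3 = 1) ∧
    (4 * ⟪u, v⟫ ^ 2 = 2 → (hyperplaneReflection u a * hyperplaneReflection v b) ^ 4 = 1) := by
  set ρ := hyperplaneReflection u a * hyperplaneReflection v b with hρ
  set c := ⟪u, v⟫ with hc
  have hcv : ⟪v, u⟫ = c := real_inner_comm _ _
  have huu := inner_self_of_unit hu
  have hvv := inner_self_of_unit hv
  have hρx : ρ x = x := by
    rw [hρ, mul_apply', (reflection_fixed hv).2 hxv, (reflection_fixed hu).2 hxu]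
  have hpow : ∀ k : ℕ, (ρ ^ k) x = x := by
    intro k
    induction k with
    | zero => rfl
    | succ k ih => rw [pow_succ, mul_apply', hρx, ih]
  have hone : ∀ k : ℕ, (∀ w, linHom (ρ ^ k) w = w) → ρ ^ k = 1 := by
    intro k h
    refine isometry_ext (x := x) ?_ (hpow k)
    refine LinearIsometryEquiv.ext fun w => ?_
    exact h w
  have step : ∀ w : E n, ∀ s t : ℝ, linHom ρ (w + s • u + t • v)
      = w + ((4 * c ^ 2 - 1) * s + 2 * c * t + (4 * c * ⟪v, w⟫ - 2 * ⟪u, w⟫)) • u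
        + (-(2 * c) * s - t - 2 * ⟪v, w⟫) • v := by
    intro w s t
    rw [hρ, linHom_reflection_mul_apply hu hv]
    simp only [inner_add_right, inner_smul_right, huu, hvv, hcv, ← hc]
    module
  have first : ∀ w : E n, linHom ρ w
      = w + (4 * c * ⟪v, w⟫ - 2 * ⟪u, w⟫) • u + (-(2 * ⟪v, w⟫)) • v := by
    intro w
    have := step w 0 0
    simp only [zero_smul, add_zero, mul_zero, zero_add, sub_zero, zero_sub] at this
    exact this
  have zero : ∀ (w : E n) (s t : ℝ), s = 0 → t = 0 → w + s • u + t • v = w := by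
    rintro w _ _ rfl rfl; module
  refine ⟨fun h => ?_, fun h => ?_, fun h => ?_, fun h => ?_⟩
  · have h2 : u = v ∨ u = -v := by
      by_contra! h2
      have := inner_sq_lt_one hu hv h2.1 h2.2
      rw [← hc, h] at this
      exact lt_irrefl _ this
    rcases h2 with h2 | h2
    · subst h2
      rw [hρ, ← hxu, ← hxv, reflection_mul_self hu]
    · have h3 : hyperplaneReflection u a = hyperplaneReflection v b := by
        rw [← reflection_neg hv, ← h2, ← hxv, ← inner_neg_left, ← h2, hxu]
      rw [hρ, h3, reflection_mul_self hv]
  · have hc0 : c = 0 := by nlinarith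
    refine hone 2 fun w => ?_
    rw [pow_two, map_mul, lin_mul_apply, first w, step]
    exact zero w _ _ (by rw [hc0]; ring) (by rw [hc0]; ring)
  · refine hone 3 fun w => ?_
    replace step := step w
    replace first := first w
    set A := 4 * c * ⟪v, w⟫ - 2 * ⟪u, w⟫ with hA
    set B := -(2 * ⟪v, w⟫) with hB
    rw [pow_succ, pow_two, map_mul, map_mul, lin_mul_apply, lin_mul_apply, first, step,
      show (4 * c ^ 2 - 1) * A + 2 * c * B + A = A + 2 * c * B by linear_combination A * h,
      show -(2 * c) * A - B - 2 * ⟪v, w⟫ = -(2 * c) * A by rw [hB]; ring, step]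
    refine zero w _ _ ?_ ?_
    · linear_combination (2 * c * B) * h
    · linear_combination (-B) * h + hB
  · refine hone 4 fun w => ?_
    replace step := step w
    replace first := first w
    set A := 4 * c * ⟪v, w⟫ - 2 * ⟪u, w⟫ with hA
    set B := -(2 * ⟪v, w⟫) with hB
    rw [pow_succ, pow_succ, pow_two, map_mul, map_mul, map_mul, lin_mul_apply, lin_mul_apply,
      lin_mul_apply, first, step,
      show (4 * c ^ 2 - 1) * A + 2 * c * B + A = 2 * A + 2 * c * B by linear_combination A * h,
      show -(2 * c) * A - B - 2 * ⟪v, w⟫ = -(2 * c) * A by rw [hB]; ring, step,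
      show (4 * c ^ 2 - 1) * (2 * A + 2 * c * B) + 2 * c * (-(2 * c) * A) + A = A + 2 * c * B by
        linear_combination (A + 2 * c * B) * h,
      show -(2 * c) * (2 * A + 2 * c * B) - -(2 * c) * A - 2 * ⟪v, w⟫ = -(2 * c) * A - B by
        linear_combination (-B) * h - hB, step]
    refine zero w _ _ ?_ ?_
    · linear_combination (2 * c * B) * h
    · linear_combination (-B) * h + hB

/-- If corresponding products of two reflections have the same order, then the angles agree,
provided both satisfy the crystallographic restriction. -/
theorem inner_sq_eq_of_pow_eq_one_iff {u v u' v' : E n} (hu : ‖u‖ = 1) (hv : ‖v‖ = 1)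
    (hu' : ‖u'‖ = 1) (hv' : ‖v'‖ = 1) {a b a' b' : ℝ} {x x' : E n} (hxu : ⟪u, x⟫ = a)
    (hxv : ⟪v, x⟫ = b) (hxu' : ⟪u', x'⟫ = a') (hxv' : ⟪v', x'⟫ = b')
    (hk : ∃ k : ℤ, 4 * ⟪u, v⟫ ^ 2 = k) (hk' : ∃ k : ℤ, 4 * ⟪u', v'⟫ ^ 2 = k)
    (h : ∀ m : ℕ, (hyperplaneReflection u a * hyperplaneReflection v b) ^ m = 1 ↔
      (hyperplaneReflection u' a' * hyperplaneReflection v' b') ^ m = 1) :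
    ⟪u, v⟫ ^ 2 = ⟪u', v'⟫ ^ 2 := by
  have bound : ∀ {u v : E n}, ‖u‖ = 1 → ‖v‖ = 1 → ⟪u, v⟫ ^ 2 ≤ 1 := by
    intro u v hu hv
    rw [sq_le_one_iff_abs_le_one]
    have := abs_real_inner_le_norm u v
    rwa [hu, hv, one_mul] at this
  -- The values 0, 1, 2, 3, 4 of `4 * c ^ 2` belong to the orders 2, 3, 4, 6, 1, which the first
  -- four powers tell apart. Without integrality, order 5 would allow two different squares.
  have cases : ∀ {c : ℝ}, c ^ 2 ≤ 1 → (∃ k : ℤ, 4 * c ^ 2 = k) →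
      4 * c ^ 2 = 0 ∨ 4 * c ^ 2 = 1 ∨ 4 * c ^ 2 = 2 ∨ 4 * c ^ 2 = 3 ∨ c ^ 2 = 1 := by
    rintro c hc ⟨k, hk⟩
    have h0 : 0 ≤ k := by
      have : (0 : ℝ) ≤ k := by rw [← hk]; positivity
      exact_mod_cast this
    have h4 : k ≤ 4 := by
      have : (k : ℝ) ≤ 4 := by rw [← hk]; linarith
      exact_mod_cast this
    interval_cases k <;> norm_num at hk <;> simp_all
  obtain ⟨p1, p2, p3, p4⟩ := pow_eq_one_of_four_mul_inner_sq hu hv hxu hxv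
  obtain ⟨q1, q2, q3, q4⟩ := pow_eq_one_of_four_mul_inner_sq hu' hv' hxu' hxv'
  obtain ⟨r1, r2, r3, r4⟩ := four_mul_inner_sq_of_pow_eq_one hu hv a b
  obtain ⟨t1, t2, t3, t4⟩ := four_mul_inner_sq_of_pow_eq_one hu' hv' a' b'
  have h1 := h 1
  rw [pow_one, pow_one] at h1
  have h2 := h 2
  have h3 := h 3
  have h4 := h 4
  generalize hyperplaneReflection u a * hyperplaneReflection v b = ρ at *
  generalize hyperplaneReflection u' a' * hyperplaneReflection v' b' = ρ' at *
  have b1 := cases (bound hu hv) hk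
  have b2 := cases (bound hu' hv') hk'
  generalize ⟪u, v⟫ ^ 2 = X at *
  generalize ⟪u', v'⟫ ^ 2 = Y at *
  rcases b1 with b | b | b | b | b <;> rcases b2 with d | d | d | d | d <;> grind

/-! ### Gram matrices, isometries and signs. -/

/-- A spanning family is determined by its Gram matrix up to a linear isometry. -/
theorem exists_isometry_of_gram_eq {ι : Type*} [Fintype ι] {β γ : ι → E n}
    (hspan : Submodule.span ℝ (Set.range β) = ⊤) (h : ∀ i j, ⟪γ i, γ j⟫ = ⟪β i, β j⟫) :
    ∃ O : E n ≃ₗᵢ[ℝ] E n, ∀ i, O (β i) = γ i := by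
  classical
  set Φ := Fintype.linearCombination ℝ β with hΦ
  set Ψ := Fintype.linearCombination ℝ γ with hΨ
  have hgram : ∀ a b, ⟪Ψ a, Ψ b⟫ = ⟪Φ a, Φ b⟫ := by
    intro a b
    simp only [hΦ, hΨ, Fintype.linearCombination_apply, sum_inner, inner_sum, inner_smul_left,
      inner_smul_right, h]
  have hsurj : LinearMap.range Φ = ⊤ := by rw [hΦ, Fintype.range_linearCombination, hspan]
  -- Any linear section `s` will do: equal Gram matrices make a combination of the `γ i` vanish
  -- whenever the same combination of the `β i` does.
  obtain ⟨s, hs⟩ := Φ.exists_rightInverse_of_surjective hsurj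
  have hs' : ∀ x, Φ (s x) = x := fun x => LinearMap.congr_fun hs x
  set O := (Ψ.comp s).isometryOfInner fun x y => by
    rw [LinearMap.comp_apply, LinearMap.comp_apply, hgram, hs', hs']
  refine ⟨O.toLinearIsometryEquiv rfl, fun i => ?_⟩
  have hi : Φ (Pi.single i 1) = β i := by simp [hΦ]
  have hi' : Ψ (Pi.single i 1) = γ i := by simp [hΨ]
  change Ψ (s (β i)) = γ i
  rw [← hi', ← sub_eq_zero, ← map_sub, ← inner_self_eq_zero (𝕜 := ℝ), hgram, map_sub, hs', hi,
    sub_self, inner_zero_left]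

/-- The nonorthogonality graph of a linearly independent family with strongly obtuse angles is a
forest, so unit vectors with the same angles up to sign have the same Gram matrix after a change of
signs. -/
theorem exists_signs {ι : Type*} [Fintype ι] {β γ : ι → E n} (hβ : ∀ i, ‖β i‖ = 1)
    (hγ : ∀ i, ‖γ i‖ = 1) (hind : LinearIndependent ℝ β)
    (hobt : ∀ i j, i ≠ j → ⟪β i, β j⟫ = 0 ∨ ⟪β i, β j⟫ ≤ -1 / 2)
    (hsq : ∀ i j, ⟪β i, β j⟫ ^ 2 = ⟪γ i, γ j⟫ ^ 2) :
    ∃ ε : ι → ℝ, (∀ i, ε i = 1 ∨ ε i = -1) ∧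
      ∀ i j, ⟪ε i • γ i, ε j • γ j⟫ = ⟪β i, β j⟫ := by
  classical
  suffices H : ∀ (N : ℕ) (J : Finset ι), J.card = N → ∃ ε : ι → ℝ, (∀ i, ε i = 1 ∨ ε i = -1) ∧
      ∀ i ∈ J, ∀ j ∈ J, i ≠ j → ε i * ε j * ⟪γ i, γ j⟫ = ⟪β i, β j⟫ by
    obtain ⟨ε, hε, h⟩ := H _ Finset.univ rfl
    refine ⟨ε, hε, fun i j => ?_⟩
    rw [inner_smul_left, inner_smul_right, conj_trivial, ← mul_assoc]
    rcases eq_or_ne i j with rfl | hij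
    · rw [inner_self_of_unit (hγ i), inner_self_of_unit (hβ i)]
      rcases hε i with h | h <;> rw [h] <;> norm_num
    · exact h i (Finset.mem_univ _) j (Finset.mem_univ _) hij
  intro N
  induction N with
  | zero =>
    intro J hJ
    refine ⟨fun _ => 1, fun _ => Or.inl rfl, fun i hi => ?_⟩
    rw [Finset.card_eq_zero.1 hJ] at hi
    exact absurd hi (Finset.notMem_empty i)
  | succ N ih =>
    intro J hJ
    have hne : J.Nonempty := Finset.card_pos.1 (by omega)
    -- a leaf of the graph
    obtain ⟨i, hi, hleaf⟩ : ∃ i ∈ J, ∀ j ∈ J.erase i, ∀ k ∈ J.erase i,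
        ⟪β i, β j⟫ ≠ 0 → ⟪β i, β k⟫ ≠ 0 → j = k := by
      by_contra! hcon
      -- Two neighbours contribute at most `-1 / 2` each and offset the unit square of `β i`. If
      -- every node had two, the sum of all vectors would be zero.
      have hle : ∀ i ∈ J, ⟪β i, ∑ j ∈ J, β j⟫ ≤ 0 := by
        intro i hi
        obtain ⟨j, hj, k, hk, hj0, hk0, hjk⟩ := hcon i hi
        have h1 := (hobt i j (Finset.ne_of_mem_erase hj).symm).resolve_left hj0
        have h2 := (hobt i k (Finset.ne_of_mem_erase hk).symm).resolve_left hk0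
        rw [← Finset.add_sum_erase J _ hi, ← Finset.add_sum_erase _ _ hj,
          ← Finset.add_sum_erase _ _ (Finset.mem_erase.2 ⟨hjk.symm, hk⟩), inner_add_right,
          inner_add_right, inner_add_right, inner_self_of_unit (hβ i)]
        have h3 : ⟪β i, ∑ l ∈ ((J.erase i).erase j).erase k, β l⟫ ≤ 0 := by
          rw [inner_sum]
          refine Finset.sum_nonpos fun l hl => ?_
          have hl' := Finset.mem_of_mem_erase (Finset.mem_of_mem_erase hl)
          rcases hobt i l (Finset.ne_of_mem_erase hl').symm with h | h <;> linarith
        linarith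
      have h0 : ∑ j ∈ J, β j = 0 := by
        rw [← inner_self_eq_zero (𝕜 := ℝ)]
        refine le_antisymm ?_ real_inner_self_nonneg
        nth_rw 1 [sum_inner]
        exact Finset.sum_nonpos hle
      obtain ⟨i, hi⟩ := hne
      have h1 := linearIndependent_iff'.1 hind J (fun _ => 1) (by simpa using h0) i hi
      exact one_ne_zero h1
    obtain ⟨ε, hε, h⟩ := ih (J.erase i) (by rw [Finset.card_erase_of_mem hi, hJ]; rfl)
    -- A leaf has at most one neighbour, so one sign suffices; the other products are zero on both
    -- sides.
    have hpm : ∃ η : ℝ, (η = 1 ∨ η = -1) ∧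
        ∀ j ∈ J.erase i, η * ε j * ⟪γ i, γ j⟫ = ⟪β i, β j⟫ := by
      have hzero : ∀ j, ⟪β i, β j⟫ = 0 → ⟪γ i, γ j⟫ = 0 := by
        intro j h0
        have := hsq i j
        rw [h0] at this
        exact pow_eq_zero_iff two_ne_zero |>.1 (by rw [← this]; norm_num)
      by_cases hex : ∃ j ∈ J.erase i, ⟪β i, β j⟫ ≠ 0
      · obtain ⟨j, hj, hj0⟩ := hex
        have hrest : ∀ k ∈ J.erase i, k ≠ j → ⟪β i, β k⟫ = 0 := by
          intro k hk hkj
          by_contra hk0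
          exact hkj (hleaf k hk j hj hk0 hj0)
        obtain ⟨η, hη, hηj⟩ : ∃ η : ℝ, (η = 1 ∨ η = -1) ∧
            η * ε j * ⟪γ i, γ j⟫ = ⟪β i, β j⟫ := by
          rcases sq_eq_sq_iff_eq_or_eq_neg.1 (hsq i j) with h1 | h1 <;> rcases hε j with h2 | h2
          · exact ⟨1, Or.inl rfl, by rw [h2, h1]; ring⟩
          · exact ⟨-1, Or.inr rfl, by rw [h2, h1]; ring⟩
          · exact ⟨-1, Or.inr rfl, by rw [h2, h1]; ring⟩
          · exact ⟨1, Or.inl rfl, by rw [h2, h1]; ring⟩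
        refine ⟨η, hη, fun k hk => ?_⟩
        rcases eq_or_ne k j with rfl | hkj
        · exact hηj
        · rw [hzero k (hrest k hk hkj), hrest k hk hkj, mul_zero]
      · push Not at hex
        exact ⟨1, Or.inl rfl, fun j hj => by rw [hzero j (hex j hj), hex j hj, mul_zero]⟩
    obtain ⟨η, hη, hηJ⟩ := hpm
    refine ⟨Function.update ε i η, fun j => ?_, fun j hj k hk hjk => ?_⟩
    · rcases eq_or_ne j i with rfl | hji
      · rwa [Function.update_self]
      · rw [Function.update_of_ne hji]; exact hε j
    · rcases eq_or_ne j i with rfl | hji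
      · rw [Function.update_self, Function.update_of_ne hjk.symm]
        exact hηJ k (Finset.mem_erase.2 ⟨hjk.symm, hk⟩)
      · rw [Function.update_of_ne hji]
        rcases eq_or_ne k i with rfl | hki
        · rw [Function.update_self, mul_comm (ε j), real_inner_comm, real_inner_comm (β k)]
          exact hηJ j (Finset.mem_erase.2 ⟨hji, hj⟩)
        · rw [Function.update_of_ne hki]
          exact h j (Finset.mem_erase.2 ⟨hji, hj⟩) k (Finset.mem_erase.2 ⟨hki, hk⟩) hjk

/-! ### The two implications. -/

namespace CoxeterPolytope

/-- Equal Gram matrices give `O`; the embedding is conjugation by `O` on linear parts, followed by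
the lift to the stabilizer of the special point `W`. A lift with the linear part of a reflection and
a fixed point is a reflection. -/
theorem embeds_of_sameDiagram {F P T : CoxeterPolytope n} {V W : E n}
    (hW : F.IsSpecialPoint W) (hTP : T.SameDiagram P)
    (hTF : T.reflectionGroup ≤ F.reflectionGroup) :
    EmbedsAsReflectionSubgroup (P.stabilizer V) (F.stabilizer W) := by
  obtain ⟨e, he⟩ := hTP
  have hlabel : ∀ i j, P.diagram i j = T.diagram (e.symm i) (e.symm j) := by
    intro i j
    rw [← he]
    rfl
  obtain ⟨O, hO⟩ := exists_isometry_of_gram_eq (γ := fun i => T.normal (e.symm i)) P.span_normal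
    (fun i j => by rw [T.inner_normal, P.inner_normal, hlabel])
  have hle : P.reflectionGroup.map linHom
      ≤ (F.reflectionGroup.map linHom).comap (MulAut.conj O).toMonoidHom := by
    rw [Subgroup.map_le_iff_le_comap, reflectionGroup, Subgroup.closure_le]
    rintro _ ⟨j, rfl⟩
    refine ⟨T.facetReflection (e.symm j), hTF (T.facetReflection_mem _), ?_⟩
    have h := linHom_conj_reflection O (P.norm_normal j) (P.offset j) (T.offset (e.symm j))
    rw [hO] at h
    exact h.symm
  have hex : ∀ g : P.stabilizer V, ∃ h : F.stabilizer W,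
      linHom (h : E n ≃ᵃⁱ[ℝ] E n) = O * linHom (g : E n ≃ᵃⁱ[ℝ] E n) * O⁻¹ := by
    intro g
    obtain ⟨k, hk, hk'⟩ := hle ⟨g, g.2.1, rfl⟩
    obtain ⟨h, hh, hhW, hlin⟩ := hW k hk
    exact ⟨⟨h, hh, hhW⟩, hlin.trans hk'⟩
  choose φ hφ using hex
  have hfix : ∀ h : F.stabilizer W, (h : E n ≃ᵃⁱ[ℝ] E n) W = W := fun h => h.2.2
  refine ⟨MonoidHom.mk' φ fun a b => Subtype.ext (isometry_ext (x := W) ?_ ?_), ?_, ?_⟩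
  · rw [hφ, Subgroup.coe_mul, Subgroup.coe_mul, map_mul, map_mul, hφ, hφ]
    group
  · rw [hfix, hfix]
  · intro a b hab
    have h1 : φ a = φ b := hab
    have h2 := hφ a
    rw [h1, hφ b] at h2
    have h3 := mul_left_cancel (mul_right_cancel h2)
    refine Subtype.ext (isometry_ext (x := V) h3.symm ?_)
    exact a.2.2.trans b.2.2.symm
  · rintro g ⟨u, b, hu, hg⟩
    refine ⟨O u, ⟪O u, W⟫, norm_linHom O hu, ?_⟩
    refine eq_reflection_of_fixed (norm_linHom O hu) (b := b) ?_ (hfix (φ g))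
    change linHom (φ g : E n ≃ᵃⁱ[ℝ] E n) = _
    rw [hφ, hg, linHom_conj_reflection O hu]

/-- An embedding of the stabilizer of a vertex that takes reflections to reflections is induced by a
linear isometry. -/
theorem exists_isometry_of_embedding {F P : CoxeterPolytope n} {V W : E n}
    (hV : V ∈ Set.extremePoints ℝ P.carrier) (φ : P.stabilizer V →* F.stabilizer W)
    (hinj : Function.Injective φ)
    (hrefl : ∀ g : P.stabilizer V, IsReflection (g : E n ≃ᵃⁱ[ℝ] E n) →
      IsReflection (φ g : E n ≃ᵃⁱ[ℝ] E n)) :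
    ∃ O : E n ≃ₗᵢ[ℝ] E n, ∀ g : P.stabilizer V,
      linHom (φ g : E n ≃ᵃⁱ[ℝ] E n) = O * linHom (g : E n ≃ᵃⁱ[ℝ] E n) * O⁻¹ := by
  have hfacet : ∀ i : P.FacetsAt V, ⟪P.normal i, V⟫ = P.offset i := fun i =>
    (sub_eq_zero.1 i.2).symm
  let r : P.FacetsAt V → P.stabilizer V := fun i =>
    ⟨P.facetReflection i, P.facetReflection_mem i,
      (reflection_fixed (P.norm_normal i)).2 (hfacet i)⟩
  choose γ b hγ hφr using fun i => hrefl (r i) ⟨_, _, P.norm_normal i, rfl⟩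
  have hγW : ∀ i, ⟪γ i, W⟫ = b i := fun i => by
    rw [← reflection_fixed (hγ i), ← hφr i]
    exact (φ (r i)).2.2
  have hγm : ∀ i, γ i ∈ F.mirrorNormals := fun i => ⟨hγ i, b i, hφr i ▸ (φ (r i)).2.1⟩
  have hsq : ∀ i j : P.FacetsAt V, ⟪P.normal i, P.normal j⟫ ^ 2 = ⟪γ i, γ j⟫ ^ 2 := by
    intro i j
    refine inner_sq_eq_of_pow_eq_one_iff (P.norm_normal i) (P.norm_normal j) (hγ i) (hγ j)
      (hfacet i) (hfacet j) (hγW i) (hγW j)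
      (P.exists_int_eq_four_mul_inner_sq (P.normal_mem_mirrorNormals i)
        (P.normal_mem_mirrorNormals j))
      (F.exists_int_eq_four_mul_inner_sq (hγm i) (hγm j)) fun m => ?_
    rw [← hφr i, ← hφr j, ← Subgroup.coe_mul, ← map_mul, ← Subgroup.coe_pow, ← map_pow,
      OneMemClass.coe_eq_one, map_eq_one_iff φ hinj, ← OneMemClass.coe_eq_one, Subgroup.coe_pow,
      Subgroup.coe_mul]
    rfl
  -- A nonzero integer `4 * c ^ 2` is at least 1, so a nonzero product of two facet normals at `V`
  -- is at most `-1 / 2`.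
  obtain ⟨ε, hε, hgram⟩ := exists_signs (β := fun i : P.FacetsAt V => P.normal i) (γ := γ)
    (fun i => P.norm_normal i) hγ (P.linearIndependent_facetsAt V) (fun i j hij => by
      have hle := P.inner_normal_nonpos fun h => hij (Subtype.ext h)
      obtain ⟨k, hk⟩ := P.exists_int_eq_four_mul_inner_sq (P.normal_mem_mirrorNormals i)
        (P.normal_mem_mirrorNormals j)
      rcases eq_or_ne k 0 with h0 | h0
      · left
        rw [h0, Int.cast_zero] at hk
        exact pow_eq_zero_iff two_ne_zero |>.1 (by linarith)
      · right
        have h1 : 1 ≤ k := by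
          have : (0 : ℝ) ≤ k := by rw [← hk]; positivity
          have : 0 ≤ k := by exact_mod_cast this
          omega
        have h2 : (1 : ℝ) ≤ k := by exact_mod_cast h1
        nlinarith) hsq
  obtain ⟨O, hO⟩ := exists_isometry_of_gram_eq (P.span_facetsAt hV) hgram
  refine ⟨O, fun g => ?_⟩
  have hr : ∀ i, linHom (φ (r i) : E n ≃ᵃⁱ[ℝ] E n)
      = O * linHom (r i : E n ≃ᵃⁱ[ℝ] E n) * O⁻¹ := by
    intro i
    rw [hφr i]
    refine Eq.trans ?_ (linHom_conj_reflection O (P.norm_normal i) (P.offset i) (ε i * b i)).symm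
    rw [hO i]
    rcases hε i with h | h
    · rw [h, one_smul, one_mul]
    · rw [h, neg_one_smul, neg_one_mul, reflection_neg (hγ i)]
  let f₁ : P.stabilizer V →* (E n ≃ₗᵢ[ℝ] E n) :=
    (linHom.comp (F.stabilizer W).subtype).comp φ
  let f₂ : P.stabilizer V →* (E n ≃ₗᵢ[ℝ] E n) :=
    (MulAut.conj O).toMonoidHom.comp (linHom.comp (P.stabilizer V).subtype)
  -- The two homomorphisms agree on the reflections in the facets through `V`, and these generate
  -- the stabilizer.
  have hgen : Subgroup.closure (P.facetReflection '' {j | P.slack j V = 0})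
      ≤ (f₁.eqLocus f₂).map (P.stabilizer V).subtype := by
    rw [Subgroup.closure_le]
    rintro _ ⟨j, hj, rfl⟩
    exact ⟨r ⟨j, hj⟩, hr ⟨j, hj⟩, rfl⟩
  obtain ⟨g', hg', hgg'⟩ := hgen (P.mem_closure_of_map_eq hV.1 g.2.1 g.2.2)
  have : g' = g := Subtype.ext hgg'
  rw [← this]
  exact hg'

theorem exists_sameDiagram_of_embeds {F P : CoxeterPolytope n} {V W : E n}
    (hV : V ∈ Set.extremePoints ℝ P.carrier) (hV' : P.IsSpecialPoint V) (hW : F.IsSpecialPoint W)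
    (h : EmbedsAsReflectionSubgroup (P.stabilizer V) (F.stabilizer W)) :
    ∃ T : CoxeterPolytope n, T.SameDiagram P ∧ T.reflectionGroup ≤ F.reflectionGroup := by
  obtain ⟨φ, hinj, hrefl⟩ := h
  obtain ⟨O, hO⟩ := exists_isometry_of_embedding hV φ hinj hrefl
  -- Facets not through `V` are covered as well: `V` is special, so a parallel mirror passes through
  -- it.
  have hmem : ∀ j, O (P.normal j) ∈ F.mirrorNormals := by
    intro j
    let g : P.stabilizer V := ⟨hyperplaneReflection (P.normal j) ⟪P.normal j, V⟫,
      hV'.reflection_mem P (P.normal_mem_mirrorNormals j),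
      (reflection_fixed (P.norm_normal j)).2 rfl⟩
    have h1 : linHom (φ g : E n ≃ᵃⁱ[ℝ] E n) = linHom (hyperplaneReflection (O (P.normal j)) 0) := by
      rw [hO g]
      exact linHom_conj_reflection O (P.norm_normal j) _ 0
    have h2 := eq_reflection_of_fixed (norm_linHom O (P.norm_normal j)) h1 (φ g).2.2
    exact ⟨norm_linHom O (P.norm_normal j), _, h2 ▸ (φ g).2.1⟩
  -- These distances put each outer facet of the new polytope on a mirror of `F`.
  choose d hd0 hd using fun j => F.exists_parallel_mirror hW (hmem j)
  classical
  refine ⟨P.moved hV O W (fun j => if P.slack j V = 0 then 0 else d j)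
    (fun j hj => if_pos hj) (fun j hj => by rw [if_neg hj]; exact hd0 j),
    P.moved_sameDiagram hV O W _ _ _, ?_⟩
  rw [reflectionGroup, Subgroup.closure_le]
  rintro _ ⟨j, rfl⟩
  change hyperplaneReflection (O (P.normal j))
    (⟪O (P.normal j), W⟫ + if P.slack j V = 0 then 0 else d j) ∈ F.reflectionGroup
  split_ifs with hj
  · rw [add_zero]
    exact hW.reflection_mem F (hmem j)
  · exact hd j

end CoxeterPolytope

end EuclideanReflection

theorem theorem2 (n : ℕ) (F P : EuclideanReflection.CoxeterPolytope n) :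
    (∃ V, P.IsSpecialVertex V) ∧ (∃ W, F.IsSpecialVertex W) ∧
    ∀ V W : EuclideanReflection.E n, P.IsSpecialVertex V → F.IsSpecialVertex W →
      ((∃ T : EuclideanReflection.CoxeterPolytope n,
          T.SameDiagram P ∧ T.reflectionGroup ≤ F.reflectionGroup) ↔
        EuclideanReflection.EmbedsAsReflectionSubgroup (P.stabilizer V) (F.stabilizer W)) := by
  refine ⟨P.exists_isSpecialVertex, F.exists_isSpecialVertex, fun V W hV hW => ?_⟩
  obtain ⟨hVe, hVs⟩ := P.isSpecialVertex_iff.1 hV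
  obtain ⟨-, hWs⟩ := F.isSpecialVertex_iff.1 hW
  constructor
  · rintro ⟨T, hTP, hTF⟩
    exact EuclideanReflection.CoxeterPolytope.embeds_of_sameDiagram hWs hTP hTF
  · exact EuclideanReflection.CoxeterPolytope.exists_sameDiagram_of_embeds hVe hVs hWs
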